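/- Setting. Let $A\in\mathbb R^{d\times n}$, $y\in\mathbb R^d$, $L\in\mathbb R^{m\times n}$, $B\in\mathbb R^{q\times m}$, $M\in\mathbb R^{p\times l}$, $\lambda>0$, and let $C\subset\mathbb R^n$ be nonempty, closed and convex with projection $P_C$. $\Gamma_0(E)$ denotes the proper lower semicontinuous convex functions $E\to\mathbb R\cup\{\infty\}$; $f^*$ is the conjugate of $f$ and $\mathrm{prox}_f(x)=\operatorname{argmin}_w[f(w)+\tfrac12\|x-w\|^2]$. Let $\varphi,f\in\Gamma_0(\mathbb R^m\times\mathbb R^l)$ and $g\in\Gamma_0(\mathbb R^p)$ satisfy $\varphi(u,\sigma)=f(u,\sigma)+g(M\sigma)$ for all $(u,\sigma)$. For every $u$ let $\varphi(u,\cdot)$ be proper and coercive, and put $$\psi(u)=\min_{\sigma\in\mathbb R^l}\varphi(u,\sigma),\quad \Psi_B(u)=\psi(u)-\inf_{v\in\mathbb R^m}\bigl[\psi(v)+\tfrac12\|B(u-v)\|^2\bigr],\quad J(x)=\tfrac12\|y-Ax\|^2+\lambda\Psi_B(Lx),$$ $\mathcal S=\operatorname{argmin}_{x\in C}J(x)$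 and $Q=A^{\mathsf T}A-\lambda L^{\mathsf T}B^{\mathsf T}BL$. Assume that (i) $\varphi$ is bounded below; (ii) either $\varphi(-u,\sigma)=\varphi(u,\sigma)$ for all $(u,\sigma)$, or $\varphi(-u,\sigma)=\varphi(u,-\sigma)$ for all $(u,\sigma)$; (iii) $0\in\mathrm{ri}[\mathrm{dom}\,\varphi-\{(Lx,\sigma): x\in\mathbb R^n,\sigma\in\mathbb R^l\}]$; (iv) $0\in\mathrm{ri}[\mathrm{dom}\,g-\{M\sigma:(u,\sigma)\in\mathrm{dom}\,f\}]$; (v) $Q\succeq O$. For $\kappa>1$ and $\gamma_1,\gamma_2,\gamma_3,\gamma_4>0$ consider the step-size condition $$(\ast)\quad \tfrac1{\gamma_1}I-\tfrac\kappa2A^{\mathsf T}A-\lambda L^{\mathsf T}L\succ O,\quad \tfrac1{\gamma_2}I-I-M^{\mathsf T}M\succ O,\quad \tfrac1{\gamma_3}\ge\bigl(\tfrac\kappa2+\tfrac2\kappa\bigr)\|B\|_{\mathrm{op}}^2,\quad \tfrac1{\gamma_4}I-\gamma_3MM^{\mathsf T}\succ O.$$ Let $\mathcal H=\mathbb R^n\times\mathbb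 R^l\times\mathbb R^m\times\mathbb R^l\times\mathbb R^m\times\mathbb R^l\times\mathbb R^p\times\mathbb R^p$ and define $T:\mathcal H\to\mathcal H$, $(x,\sigma,v,\tau,r,\eta,\xi,\zeta)\mapsto(\hat x,\hat\sigma,\hat v,\hat\tau,\hat r,\hat\eta,\hat\xi,\hat\zeta)$, by $$\begin{aligned} \hat x&=P_C[x-\gamma_1(Qx-A^{\mathsf T}y+\lambda L^{\mathsf T}B^{\mathsf T}Bv+\lambda L^{\mathsf T}r)],\qquad \hat\sigma=\sigma-\gamma_2(\eta+M^{\mathsf T}\xi),\\ (\hat v,\hat\tau)&=\mathrm{prox}_{\gamma_3f}\bigl(v+\gamma_3B^{\mathsf T}B(L(2\hat x-x)-v),\ \tau-\gamma_3M^{\mathsf T}\zeta\bigr),\\ (\hat r,\hat\eta)&=\mathrm{prox}_{f^*}\bigl(r+L(2\hat x-x),\ \eta+2\hat\sigma-\sigma\bigr),\\ \hat\xi&=\mathrm{prox}_{g^*}(\xi+M(2\hat\sigma-\sigma)),\qquad \hat\zeta=\mathrm{prox}_{\gamma_4g^*}(\zeta+\gamma_4M(2\hat\tau-\tau)). \end{aligned}$$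 Let $P:\mathcal H\to\mathcal H$ be the linear operator sending $(x,\sigma,v,\tau,r,\eta,\xi,\zeta)$ to $$\bigl(\tfrac1{\gamma_1}x-\lambda L^{\mathsf T}B^{\mathsf T}Bv-\lambda L^{\mathsf T}r,\ \tfrac\lambda{\gamma_2}\sigma-\lambda\eta-\lambda M^{\mathsf T}\xi,\ \tfrac\lambda{\gamma_3}v-\lambda B^{\mathsf T}BLx,\ \tfrac\lambda{\gamma_3}\tau-\lambda M^{\mathsf T}\zeta,\ \lambda r-\lambda Lx,\ \lambda\eta-\lambda\sigma,\ \lambda\xi-\lambda M\sigma,\ \tfrac\lambda{\gamma_4}\zeta-\lambda M\tau\bigr).$$ Theorem. For every $\kappa>1$ and all $\gamma_1,\dots,\gamma_4>0$ satisfying $(\ast)$: (a) $x^\star\in\mathcal S$ if and only if there exist $(\sigma^\star,v^\star,\tau^\star,r^\star,\eta^\star,\xi^\star,\zeta^\star)$ with $(x^\star,\sigma^\star,v^\star,\tau^\star,r^\star,\eta^\star,\xi^\star,\zeta^\star)\in\mathrm{Fix}(T)$. (b) $P$ is symmetric positive definite, and $T$ is $\tfrac{\kappa}{2\kappa-1}$-averaged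 nonexpansive for the norm $\|z\|_P=\sqrt{\langle z,Pz\rangle}$; that is, $T$ is nonexpansive, $\tfrac{\kappa}{2\kappa-1}\in(0,1)$, and $T=(1-\tfrac{\kappa}{2\kappa-1})\mathrm{Id}+\tfrac{\kappa}{2\kappa-1}R$ for some $R$ that is nonexpansive for $\|\cdot\|_P$. (c) If $\mathcal S\ne\varnothing$, then for every initial point $z_0\in\mathcal H$ the $x$-components $x_k$ of the iterates $z_{k+1}=T(z_k)$ of the algorithm converge to a point of $\mathcal S$, i.e. to a global minimizer of $J$ over $C$. Moreover, for every $\kappa>1$ and $\delta>0$ the positive numbers $\gamma_1=1/(\|\tfrac\kappa2A^{\mathsf T}A+\lambda L^{\mathsf T}L\|_{\mathrm{op}}+\delta)$, $\gamma_2=1/(\|M\|_{\mathrm{op}}^2+1+\delta)$, $\gamma_3=1/((\tfrac\kappa2+\tfrac2\kappa)\|B\|_{\mathrm{op}}^2+\delta)$, $\gamma_4=1/(\gamma_3\|M\|_{\mathrm{op}}^2+\delta)$ satisfy $(\ast)$; and $\mathcal S\neq\varnothing$ if $C$ is bounded. -/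

import Mathlib

open Filter Topology Set
open scoped Pointwise Matrix

noncomputable section

namespace GMEMI

/-! ### Euclidean spaces and their products -/

/-- The Euclidean space `ℝⁿ`. -/
abbrev Vec (n : ℕ) : Type := EuclideanSpace ℝ (Fin n)

/-- The product `ℝᵃ × ℝᵇ` with its standard Euclidean structure. -/
abbrev Pair (a b : ℕ) : Type := WithLp 2 (Vec a × Vec b)

/-- The element `(u, σ)` of `ℝᵃ × ℝᵇ`. -/
abbrev pair {a b : ℕ} (u : Vec a) (σ : Vec b) : Pair a b := WithLp.toLp 2 (u, σ)

/-- The matrix-vector product, as a linear map between Euclidean spaces. -/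
abbrev act {a b : ℕ} (K : Matrix (Fin a) (Fin b) ℝ) : Vec b →ₗ[ℝ] Vec a :=
  Matrix.toEuclideanLin K

/-- The operator norm of a matrix with respect to Euclidean norms. -/
def opNorm {a b : ℕ} (K : Matrix (Fin a) (Fin b) ℝ) : ℝ :=
  ‖LinearMap.toContinuousLinearMap (act K)‖

/-! ### Extended-real-valued convex analysis

Functions with values in `ℝ ∪ {∞}` are functions to `EReal` that never take the value `⊥`. -/

section Convex

variable {E : Type*} [NormedAddCommGroup E] [InnerProductSpace ℝ E]

/-- The effective domain. -/
def dom (f : E → EReal) : Set E := {x | f x < ⊤}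

/-- A proper function `E → ℝ ∪ {∞}`. -/
def Proper (f : E → EReal) : Prop := (∀ x, f x ≠ ⊥) ∧ (dom f).Nonempty

/-- The convexity inequality for functions `E → ℝ ∪ {∞}`. -/
def ConvexFun (f : E → EReal) : Prop :=
  ∀ x y : E, ∀ a : ℝ, 0 < a → a < 1 →
    f (a • x + (1 - a) • y) ≤ (a : EReal) * f x + ((1 - a : ℝ) : EReal) * f y

/-- The class `Γ₀(E)` of proper lower semicontinuous convex functions `E → ℝ ∪ {∞}`. -/
def Gamma0 (f : E → EReal) : Prop := Proper f ∧ LowerSemicontinuous f ∧ ConvexFun f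

/-- Coercivity: `f x → ∞` as `‖x‖ → ∞`. -/
def Coercive (f : E → EReal) : Prop := Tendsto f (Bornology.cobounded E) (𝓝 ⊤)

/-- The conjugate `f*`. -/
def conj (f : E → EReal) (u : E) : EReal := ⨆ x : E, ((inner ℝ x u : ℝ) : EReal) - f x

/-- `p` minimizes `f + ½‖x - ·‖²`. -/
def IsProx (f : E → EReal) (x p : E) : Prop :=
  ∀ w : E, f p + ((1 / 2 * ‖x - p‖ ^ 2 : ℝ) : EReal) ≤ f w + ((1 / 2 * ‖x - w‖ ^ 2 : ℝ) : EReal)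

/-- The proximity operator: the minimizer of `f + ½‖x - ·‖²` (unique for `f ∈ Γ₀(E)`). -/
def prox (f : E → EReal) (x : E) : E := Classical.epsilon (IsProx f x)

/-- The function `γ f`. -/
def scale (γ : ℝ) (f : E → EReal) (x : E) : EReal := (γ : EReal) * f x

/-- The projection onto `C`: the point of `C` nearest to `x` (unique for `C` nonempty, closed and
convex). -/
def proj (C : Set E) (x : E) : E :=
  Classical.epsilon fun p => p ∈ C ∧ ∀ w ∈ C, ‖x - p‖ ≤ ‖x - w‖

end Convex

/-! ### Averaged nonexpansive operators, with respect to a given norm function `N` -/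

section Averaged

variable {E : Type*} [AddCommGroup E] [Module ℝ E]

/-- Nonexpansiveness of `T` for `N`. -/
def Nonexpansive (N : E → ℝ) (T : E → E) : Prop := ∀ z w, N (T z - T w) ≤ N (z - w)

/-- `T` is `α`-averaged nonexpansive for `N`. -/
def AveragedNonexpansive (N : E → ℝ) (α : ℝ) (T : E → E) : Prop :=
  Nonexpansive N T ∧ 0 < α ∧ α < 1 ∧
    ∃ R : E → E, Nonexpansive N R ∧ ∀ z, T z = (1 - α) • z + α • R z

end Averaged

/-! ### The model -/

variable {d n m l p q : ℕ}

/-- The minimization induced penalty `ψ(u) = min_σ φ(u, σ)`. -/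
def psi (φ : Pair m l → EReal) (u : Vec m) : EReal := ⨅ σ : Vec l, φ (pair u σ)

/-- The generalized Moreau enhanced penalty
`Ψ_B(u) = ψ(u) - inf_v [ψ(v) + ½‖B(u - v)‖²]`. -/
def Psi (φ : Pair m l → EReal) (B : Matrix (Fin q) (Fin m) ℝ) (u : Vec m) : EReal :=
  psi φ u - ⨅ v : Vec m, psi φ v + ((1 / 2 * ‖act B (u - v)‖ ^ 2 : ℝ) : EReal)

/-- The cost function `J(x) = ½‖y - A x‖² + λ Ψ_B(L x)`. -/
def J (A : Matrix (Fin d) (Fin n) ℝ) (y : Vec d) (L : Matrix (Fin m) (Fin n) ℝ)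
    (B : Matrix (Fin q) (Fin m) ℝ) (lam : ℝ) (φ : Pair m l → EReal) (x : Vec n) : EReal :=
  ((1 / 2 * ‖y - act A x‖ ^ 2 : ℝ) : EReal) + (lam : EReal) * Psi φ B (act L x)

/-- The solution set `argmin_{x ∈ C} J(x)`. -/
def Sol (A : Matrix (Fin d) (Fin n) ℝ) (y : Vec d) (L : Matrix (Fin m) (Fin n) ℝ)
    (B : Matrix (Fin q) (Fin m) ℝ) (lam : ℝ) (φ : Pair m l → EReal) (C : Set (Vec n)) :
    Set (Vec n) :=
  {x | x ∈ C ∧ ∀ w ∈ C, J A y L B lam φ x ≤ J A y L B lam φ w}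

/-- `Q = AᵀA - λ LᵀBᵀB L`. -/
def Q (A : Matrix (Fin d) (Fin n) ℝ) (L : Matrix (Fin m) (Fin n) ℝ)
    (B : Matrix (Fin q) (Fin m) ℝ) (lam : ℝ) : Matrix (Fin n) (Fin n) ℝ :=
  Aᵀ * A - lam • (Lᵀ * Bᵀ * B * L)

/-- The map `(x, σ) ↦ (L x, σ)`. -/
def Lbar (L : Matrix (Fin m) (Fin n) ℝ) (w : Pair n l) : Pair m l := pair (act L w.fst) w.snd

/-- The map `(u, σ) ↦ M σ`. -/
def Mbar (M : Matrix (Fin p) (Fin l) ℝ) (w : Pair m l) : Vec p := act M w.snd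

/-- The condition on the step-size parameters. -/
def StepSizes (A : Matrix (Fin d) (Fin n) ℝ) (L : Matrix (Fin m) (Fin n) ℝ)
    (B : Matrix (Fin q) (Fin m) ℝ) (M : Matrix (Fin p) (Fin l) ℝ)
    (lam κ γ₁ γ₂ γ₃ γ₄ : ℝ) : Prop :=
  ((1 / γ₁) • (1 : Matrix (Fin n) (Fin n) ℝ) - (κ / 2) • (Aᵀ * A) - lam • (Lᵀ * L)).PosDef ∧
  ((1 / γ₂) • (1 : Matrix (Fin l) (Fin l) ℝ) - 1 - Mᵀ * M).PosDef ∧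
  (κ / 2 + 2 / κ) * opNorm B ^ 2 ≤ 1 / γ₃ ∧
  ((1 / γ₄) • (1 : Matrix (Fin p) (Fin p) ℝ) - γ₃ • (M * Mᵀ)).PosDef

/-! ### The space of all variables -/

/-- `ℋ = ℝⁿ × ℝˡ × ℝᵐ × ℝˡ × ℝᵐ × ℝˡ × ℝᵖ × ℝᵖ` with its standard Euclidean structure. -/
abbrev H (n l m p : ℕ) : Type :=
  WithLp 2 (Vec n × WithLp 2 (Vec l × WithLp 2 (Vec m × WithLp 2 (Vec l ×
    WithLp 2 (Vec m × WithLp 2 (Vec l × WithLp 2 (Vec p × Vec p)))))))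

/-- The element `(x, σ, v, τ, r, η, ξ, ζ)` of `ℋ`. -/
def mk (x : Vec n) (σ : Vec l) (v : Vec m) (τ : Vec l) (r : Vec m) (η : Vec l) (ξ ζ : Vec p) :
    H n l m p :=
  WithLp.toLp 2 (x, WithLp.toLp 2 (σ, WithLp.toLp 2 (v, WithLp.toLp 2 (τ,
    WithLp.toLp 2 (r, WithLp.toLp 2 (η, WithLp.toLp 2 (ξ, ζ)))))))

/-- The `x`-block. -/
def bx (z : H n l m p) : Vec n := z.fst

/-- The `σ`-block. -/
def bσ (z : H n l m p) : Vec l := z.snd.fst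

/-- The `v`-block. -/
def bv (z : H n l m p) : Vec m := z.snd.snd.fst

/-- The `τ`-block. -/
def bτ (z : H n l m p) : Vec l := z.snd.snd.snd.fst

/-- The `r`-block. -/
def br (z : H n l m p) : Vec m := z.snd.snd.snd.snd.fst

/-- The `η`-block. -/
def bη (z : H n l m p) : Vec l := z.snd.snd.snd.snd.snd.fst

/-- The `ξ`-block. -/
def bξ (z : H n l m p) : Vec p := z.snd.snd.snd.snd.snd.snd.fst

/-- The `ζ`-block. -/
def bζ (z : H n l m p) : Vec p := z.snd.snd.snd.snd.snd.snd.snd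

/-- The operator `P` on `ℋ`. -/
def P (L : Matrix (Fin m) (Fin n) ℝ) (B : Matrix (Fin q) (Fin m) ℝ)
    (M : Matrix (Fin p) (Fin l) ℝ) (lam γ₁ γ₂ γ₃ γ₄ : ℝ) : H n l m p →ₗ[ℝ] H n l m p where
  toFun z := mk
    ((1 / γ₁) • bx z - lam • act (Lᵀ * Bᵀ * B) (bv z) - lam • act Lᵀ (br z))
    ((lam / γ₂) • bσ z - lam • bη z - lam • act Mᵀ (bξ z))
    ((lam / γ₃) • bv z - lam • act (Bᵀ * B * L) (bx z))
    ((lam / γ₃) • bτ z - lam • act Mᵀ (bζ z))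
    (lam • br z - lam • act L (bx z))
    (lam • bη z - lam • bσ z)
    (lam • bξ z - lam • act M (bσ z))
    ((lam / γ₄) • bζ z - lam • act M (bτ z))
  map_add' z w := by
    have hx : bx (z + w) = bx z + bx w := rfl
    have hσ : bσ (z + w) = bσ z + bσ w := rfl
    have hv : bv (z + w) = bv z + bv w := rfl
    have hτ : bτ (z + w) = bτ z + bτ w := rfl
    have hr : br (z + w) = br z + br w := rfl
    have hη : bη (z + w) = bη z + bη w := rfl
    have hξ : bξ (z + w) = bξ z + bξ w := rfl
    have hζ : bζ (z + w) = bζ z + bζ w := rfl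
    have hmk : ∀ (x x' : Vec n) (σ σ' : Vec l) (v v' : Vec m) (τ τ' : Vec l) (r r' : Vec m)
        (η η' : Vec l) (ξ ξ' ζ ζ' : Vec p), mk x σ v τ r η ξ ζ + mk x' σ' v' τ' r' η' ξ' ζ' =
        mk (x + x') (σ + σ') (v + v') (τ + τ') (r + r') (η + η') (ξ + ξ') (ζ + ζ') :=
      fun _ _ _ _ _ _ _ _ _ _ _ _ _ _ _ _ => rfl
    rw [hmk, hx, hσ, hv, hτ, hr, hη, hξ, hζ]
    simp only [map_add]
    congr 1 <;> module
  map_smul' c z := by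
    have hx : bx (c • z) = c • bx z := rfl
    have hσ : bσ (c • z) = c • bσ z := rfl
    have hv : bv (c • z) = c • bv z := rfl
    have hτ : bτ (c • z) = c • bτ z := rfl
    have hr : br (c • z) = c • br z := rfl
    have hη : bη (c • z) = c • bη z := rfl
    have hξ : bξ (c • z) = c • bξ z := rfl
    have hζ : bζ (c • z) = c • bζ z := rfl
    have hmk : ∀ (x : Vec n) (σ : Vec l) (v : Vec m) (τ : Vec l) (r : Vec m)
        (η : Vec l) (ξ ζ : Vec p), c • mk x σ v τ r η ξ ζ =
        mk (c • x) (c • σ) (c • v) (c • τ) (c • r) (c • η) (c • ξ) (c • ζ) :=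
      fun _ _ _ _ _ _ _ _ => rfl
    rw [RingHom.id_apply, hmk, hx, hσ, hv, hτ, hr, hη, hξ, hζ]
    simp only [map_smul]
    congr 1 <;> module

/-- Positive definiteness of a self-adjoint operator. -/
def PosDefOp {E : Type*} [NormedAddCommGroup E] [InnerProductSpace ℝ E] (K : E →ₗ[ℝ] E) : Prop :=
  K.IsSymmetric ∧ ∀ z : E, z ≠ 0 → 0 < (inner ℝ z (K z) : ℝ)

/-- The norm `‖z‖_K = √⟨z, K z⟩`. -/
def opWeightedNorm {E : Type*} [NormedAddCommGroup E] [InnerProductSpace ℝ E]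
    (K : E →ₗ[ℝ] E) (z : E) : ℝ :=
  Real.sqrt (inner ℝ z (K z))

/-! ### The operator and the algorithm -/

/-- The operator `T_GME-MI`. -/
def T (A : Matrix (Fin d) (Fin n) ℝ) (y : Vec d) (L : Matrix (Fin m) (Fin n) ℝ)
    (B : Matrix (Fin q) (Fin m) ℝ) (M : Matrix (Fin p) (Fin l) ℝ) (lam : ℝ) (C : Set (Vec n))
    (f : Pair m l → EReal) (g : Vec p → EReal) (γ₁ γ₂ γ₃ γ₄ : ℝ) (z : H n l m p) : H n l m p :=
  let x' : Vec n := proj C (bx z - γ₁ • (act (Q A L B lam) (bx z) - act Aᵀ y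
    + lam • act (Lᵀ * Bᵀ * B) (bv z) + lam • act Lᵀ (br z)))
  let σ' : Vec l := bσ z - γ₂ • (bη z + act Mᵀ (bξ z))
  let vτ' : Pair m l := prox (scale γ₃ f)
    (pair (bv z + γ₃ • act (Bᵀ * B) (act L ((2 : ℝ) • x' - bx z) - bv z))
      (bτ z - γ₃ • act Mᵀ (bζ z)))
  let rη' : Pair m l := prox (conj f)
    (pair (br z + act L ((2 : ℝ) • x' - bx z)) (bη z + (2 : ℝ) • σ' - bσ z))
  let ξ' : Vec p := prox (conj g) (bξ z + act M ((2 : ℝ) • σ' - bσ z))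
  let ζ' : Vec p := prox (scale γ₄ (conj g))
    (bζ z + γ₄ • act M ((2 : ℝ) • vτ'.snd - bτ z))
  mk x' σ' vτ'.fst vτ'.snd rη'.fst rη'.snd ξ' ζ'

/-- One pass through the loop of the algorithm, from the `k`-th to the `(k+1)`-st values. -/
def algStep (A : Matrix (Fin d) (Fin n) ℝ) (y : Vec d) (L : Matrix (Fin m) (Fin n) ℝ)
    (B : Matrix (Fin q) (Fin m) ℝ) (M : Matrix (Fin p) (Fin l) ℝ) (lam : ℝ) (C : Set (Vec n))
    (f : Pair m l → EReal) (g : Vec p → EReal) (γ₁ γ₂ γ₃ γ₄ : ℝ) (z : H n l m p) : H n l m p :=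
  let x' : Vec n := proj C (bx z - γ₁ • (act (Q A L B lam) (bx z) - act Aᵀ y
    + lam • act Lᵀ (act (Bᵀ * B) (bv z) + br z)))
  let σ' : Vec l := bσ z - γ₂ • (bη z + act Mᵀ (bξ z))
  let u' : Vec m := act L ((2 : ℝ) • x' - bx z)
  let vτ' : Pair m l := prox (scale γ₃ f)
    (pair (bv z + γ₃ • act (Bᵀ * B) (u' - bv z)) (bτ z - γ₃ • act Mᵀ (bζ z)))
  let rη' : Pair m l := prox (conj f)
    (pair (br z + u') (bη z + (2 : ℝ) • σ' - bσ z))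
  let ξ' : Vec p := prox (conj g) (bξ z + act M ((2 : ℝ) • σ' - bσ z))
  let ζ' : Vec p := prox (scale γ₄ (conj g))
    (bζ z + γ₄ • act M ((2 : ℝ) • vτ'.snd - bτ z))
  mk x' σ' vτ'.fst vτ'.snd rη'.fst rη'.snd ξ' ζ'

/-- The iterates of the algorithm started at `z₀`. -/
def iterates (A : Matrix (Fin d) (Fin n) ℝ) (y : Vec d) (L : Matrix (Fin m) (Fin n) ℝ)
    (B : Matrix (Fin q) (Fin m) ℝ) (M : Matrix (Fin p) (Fin l) ℝ) (lam : ℝ) (C : Set (Vec n))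
    (f : Pair m l → EReal) (g : Vec p → EReal) (γ₁ γ₂ γ₃ γ₄ : ℝ) (z₀ : H n l m p) :
    ℕ → H n l m p
  | 0 => z₀
  | k + 1 => algStep A y L B M lam C f g γ₁ γ₂ γ₃ γ₄
      (iterates A y L B M lam C f g γ₁ γ₂ γ₃ γ₄ z₀ k)

end GMEMI

end

open GMEMI

/-!
The assumptions on the seed make its partial minimum `ψ` real-valued, convex, even and bounded
below. Hence `J` is real-valued, and `J = s + λ ψ ∘ L` where `s` collects the least-squares term and
minus `λ` times the generalized Moreau envelope `u ↦ min_v [ψ v + ½‖B(u - v)‖²]` at `L x`. The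
minimum in the envelope is attained because `ψ` is even: a direction along which `ψ` stays bounded
above is one along which it is constant (`exists_min_even_add_sq`). The envelope is differentiable,
with gradient `Bᵀ B (u - v)` at `u` for any minimizer `v`, and `Q ⪰ 0` makes `J` convex although the
envelope enters with a minus sign (`envelope_le`, `le_envelope`).

Fixed points. `x` minimizes `J` over `C` exactly if `-∇s(x) - λ Lᵀ r` is normal to `C` at `x` for
some subgradient `r` of `ψ` at `L x` (`mem_sol_iff`). Subgradients `r` of `ψ` are those `r` for which
`(r, 0)` is a subgradient of the seed, and the relative interior condition on `g` splits `(r, 0)` by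
the sum and chain rule for `f + g ∘ M̄` (`isSubgrad_add_comp_iff`). Both steps rest on one separation
theorem, `exists_linear_le_of_mem_intrinsicInterior`. As proximity operators are resolvents of
subdifferentials, and that of a conjugate is given by Moreau's identity, the resulting system is the
equation `z = T z` (`T_eq_iff`, `mem_sol_iff_stepRel`).

Averagedness. `w = T z` means `P (z - w) ∈ 𝒜 w + F z`, where `𝒜` is the sum of a subdifferential and
a skew-symmetric map and `F` is affine with linear part `diag(Q, 0, λ BᵀB, 0, …, 0)`: a
forward-backward step in the metric `P`. The step-size condition gives `P ≻ 0` and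
`P ⪰ (κ/2) diag(Q, 0, λ BᵀB, 0, …, 0)` by completing squares (`P_posDefOp`), and with the
monotonicity of `𝒜` this yields the averagedness inequality (`StepRel.averaged`). Convergence of the
iterates is then the Krasnosel'skiĭ–Mann theorem (`tendsto_fixedPoint_of_averaged`).

All subgradients and convexity inequalities refer to the real numbers above the values of the
functions, which keeps `EReal` arithmetic out of the convex analysis.
-/

namespace GMEMI

/-! ### Subgradients and proximity operators -/

section Subgradient

section Values

variable {E : Type*}

lemma exists_coe_eq {f : E → EReal} (hf : ∀ x, f x ≠ ⊥) {x : E} {t : ℝ} (h : f x ≤ t) :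
    ∃ a : ℝ, f x = a :=
  ⟨(f x).toReal, (EReal.coe_toReal (ne_of_lt (h.trans_lt (EReal.coe_lt_top t))) (hf x)).symm⟩

lemma Proper.exists_coe {f : E → EReal} (hf : Proper f) : ∃ (x : E) (a : ℝ), f x = a := by
  obtain ⟨x, hx⟩ := hf.2
  exact ⟨x, (f x).toReal, (EReal.coe_toReal (ne_of_lt hx) (hf.1 x)).symm⟩

lemma scale_le {f : E → EReal} {γ : ℝ} (hγ : 0 < γ) {x : E} {t : ℝ} (h : f x ≤ t) :
    scale γ f x ≤ ((γ * t : ℝ) : EReal) := by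
  rw [scale, EReal.coe_mul]
  exact mul_le_mul_of_nonneg_left h (EReal.coe_nonneg.2 hγ.le)

lemma scale_one (f : E → EReal) : scale 1 f = f := by
  funext x
  rw [scale, EReal.coe_one, one_mul]

end Values

variable {E : Type*} [NormedAddCommGroup E] [InnerProductSpace ℝ E]

/-- Convexity of `{(x, t) : f x ≤ t}`, the part of the epigraph at real heights. It is the form of
convexity that avoids arithmetic in `EReal`. -/
def EpiConvex (f : E → EReal) : Prop :=
  ∀ (x y : E) (s t a : ℝ), 0 < a → a < 1 → f x ≤ s → f y ≤ t →
    f (a • x + (1 - a) • y) ≤ ((a * s + (1 - a) * t : ℝ) : EReal)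

/-- `u` is a subgradient of `f` at `x`, where `f x` is finite. The values of `f` enter only through
the real numbers above them. -/
def IsSubgrad (f : E → EReal) (x u : E) : Prop :=
  ∃ a : ℝ, f x = a ∧ ∀ (w : E) (t : ℝ), f w ≤ t → a + inner ℝ u (w - x) ≤ t

lemma ConvexFun.epiConvex {f : E → EReal} (hf : ConvexFun f) : EpiConvex f := by
  intro x y s t a ha ha1 hs ht
  refine (hf x y a ha ha1).trans ?_
  rw [EReal.coe_add, EReal.coe_mul, EReal.coe_mul]
  exact add_le_add (mul_le_mul_of_nonneg_left hs (EReal.coe_nonneg.2 ha.le))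
    (mul_le_mul_of_nonneg_left ht (EReal.coe_nonneg.2 (sub_nonneg.2 ha1.le)))

lemma IsSubgrad.monotone {f : E → EReal} {x y u v : E} (h : IsSubgrad f x u)
    (h' : IsSubgrad f y v) : 0 ≤ inner ℝ (u - v) (x - y) := by
  obtain ⟨a, ha, h⟩ := h
  obtain ⟨b, hb, h'⟩ := h'
  have h1 := h y b hb.le
  have h2 := h' x a ha.le
  simp only [inner_sub_left, inner_sub_right] at *
  linarith

/-- The first-order coefficient of a quadratic that is nonnegative to the right of zero. -/
lemma nonneg_of_quadratic {A K : ℝ} (h : ∀ s : ℝ, 0 < s → s < 1 → 0 ≤ s * A + s ^ 2 * K) :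
    0 ≤ A := by
  by_contra! hA
  have hK : 0 < 2 * (|K| + 1) := by positivity
  set s := min (1 / 2) (-A / (2 * (|K| + 1))) with hs
  have hs0 : 0 < s := lt_min (by norm_num) (div_pos (by linarith) hK)
  have hs1 : s < 1 := (min_le_left _ _).trans_lt (by norm_num)
  have hs2 : s * (2 * (|K| + 1)) ≤ -A := (le_div_iff₀ hK).1 (min_le_right _ _)
  have h1 := h s hs0 hs1
  have h2 : 0 ≤ A + s * K := by
    by_contra! hneg
    nlinarith
  have h3 : s * K ≤ s * |K| := mul_le_mul_of_nonneg_left (le_abs_self K) hs0.le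
  nlinarith

/-- First-order optimality for `f + ½γ⁻¹‖x - ·‖²`. -/
lemma isSubgrad_of_min {f : E → EReal} (hf : EpiConvex f) {γ a : ℝ} (hγ : 0 < γ) {x p : E}
    (ha : f p = a)
    (h : ∀ (w : E) (t : ℝ), f w ≤ t →
      γ * a + 1 / 2 * ‖x - p‖ ^ 2 ≤ γ * t + 1 / 2 * ‖x - w‖ ^ 2) :
    IsSubgrad f p ((1 / γ) • (x - p)) := by
  refine ⟨a, ha, fun w t hw => ?_⟩
  have key : 0 ≤ γ * (t - a) - inner ℝ (x - p) (w - p) := by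
    apply nonneg_of_quadratic (K := 1 / 2 * ‖w - p‖ ^ 2)
    intro s hs hs1
    have h1 := h _ _ (hf w p t a s hs hs1 hw ha.le)
    have h2 : x - (s • w + (1 - s) • p) = (x - p) - s • (w - p) := by module
    rw [h2, norm_sub_sq_real (x - p), inner_smul_right, norm_smul, Real.norm_eq_abs, mul_pow,
      sq_abs] at h1
    linarith
  rw [inner_smul_left]
  have h3 : 0 ≤ (1 / γ) * (γ * (t - a) - inner ℝ (x - p) (w - p)) := by positivity
  have h4 : (1 / γ) * (γ * (t - a)) = t - a := by field_simp
  rw [mul_sub, h4] at h3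
  simp only [RCLike.conj_to_real]
  linarith

/-- `p` is a proximal point of `γ f` at `x` exactly if `(x - p) / γ` is a subgradient at `p`. -/
lemma isProx_scale_iff {f : E → EReal} (hbot : ∀ x, f x ≠ ⊥) (hconv : EpiConvex f)
    (hne : ∃ (x : E) (a : ℝ), f x = a) {γ : ℝ} (hγ : 0 < γ) {x p : E} :
    IsProx (scale γ f) x p ↔ IsSubgrad f p ((1 / γ) • (x - p)) := by
  constructor
  · intro h
    have hfin : f p ≠ ⊤ := by
      intro htop
      obtain ⟨x₀, a₀, h₀⟩ := hne
      have h1 := h x₀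
      rw [scale, scale, htop, h₀, EReal.coe_mul_top_of_pos hγ, EReal.top_add_coe,
        ← EReal.coe_mul, ← EReal.coe_add] at h1
      exact absurd h1 (not_le.2 (EReal.coe_lt_top _))
    have ha : f p = (f p).toReal := (EReal.coe_toReal hfin (hbot p)).symm
    refine isSubgrad_of_min hconv hγ ha fun w t hw => ?_
    have h1 := (h w).trans (add_le_add (scale_le hγ hw) le_rfl)
    rw [scale, ha, ← EReal.coe_mul, ← EReal.coe_add, ← EReal.coe_add, EReal.coe_le_coe_iff] at h1
    exact h1
  · rintro ⟨a, ha, h⟩ w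
    rcases eq_or_ne (f w) ⊤ with htop | hfin
    · rw [scale, scale, htop, EReal.coe_mul_top_of_pos hγ, EReal.top_add_coe]
      exact le_top
    have hb : f w = (f w).toReal := (EReal.coe_toReal hfin (hbot w)).symm
    have h1 := h w _ hb.le
    rw [scale, scale, ha, hb, ← EReal.coe_mul, ← EReal.coe_mul, ← EReal.coe_add, ← EReal.coe_add,
      EReal.coe_le_coe_iff]
    have h2 : x - w = (x - p) - (w - p) := by abel
    rw [h2, norm_sub_sq_real (x - p)]
    rw [inner_smul_left, RCLike.conj_to_real] at h1
    have h3 : γ * (a + 1 / γ * inner ℝ (x - p) (w - p)) ≤ γ * (f w).toReal :=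
      mul_le_mul_of_nonneg_left h1 hγ.le
    have h4 : γ * (a + 1 / γ * inner ℝ (x - p) (w - p)) = γ * a + inner ℝ (x - p) (w - p) := by
      field_simp
    nlinarith [sq_nonneg ‖w - p‖]

/-- The proximity operator is the resolvent of the subdifferential, wherever that is defined. -/
lemma prox_scale_eq_iff {f : E → EReal} (hbot : ∀ x, f x ≠ ⊥) (hconv : EpiConvex f)
    (hne : ∃ (x : E) (a : ℝ), f x = a) {γ : ℝ} (hγ : 0 < γ) {x p : E}
    (hex : ∃ p, IsSubgrad f p ((1 / γ) • (x - p))) :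
    prox (scale γ f) x = p ↔ IsSubgrad f p ((1 / γ) • (x - p)) := by
  have hspec : IsSubgrad f (prox (scale γ f) x) ((1 / γ) • (x - prox (scale γ f) x)) := by
    rw [← isProx_scale_iff hbot hconv hne hγ]
    obtain ⟨p', hp'⟩ := hex
    exact Classical.epsilon_spec ⟨p', (isProx_scale_iff hbot hconv hne hγ).2 hp'⟩
  refine ⟨fun h => h ▸ hspec, fun h => ?_⟩
  have h1 := hspec.monotone h
  set p' := prox (scale γ f) x
  have h2 : (1 / γ) • (x - p') - (1 / γ) • (x - p) = -((1 / γ) • (p' - p)) := by module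
  rw [h2, inner_neg_left, inner_smul_left, real_inner_self_eq_norm_sq, RCLike.conj_to_real] at h1
  have h3 : ‖p' - p‖ ^ 2 ≤ 0 := by
    have : 0 < 1 / γ := by positivity
    by_contra! hpos
    nlinarith [mul_pos this hpos]
  have h4 : ‖p' - p‖ = 0 := by nlinarith [norm_nonneg (p' - p)]
  exact sub_eq_zero.1 (norm_eq_zero.1 h4)

/-- The subdifferential of a function of class `Γ₀` has full resolvents. Convexity bounds `f` below
by a multiple of the norm, so the quadratic term makes the objective coercive. -/
lemma Gamma0.exists_isSubgrad [FiniteDimensional ℝ E] {f : E → EReal} (hf : Gamma0 f) {γ : ℝ}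
    (hγ : 0 < γ) (x : E) : ∃ p, IsSubgrad f p ((1 / γ) • (x - p)) := by
  obtain ⟨hprop, hlsc, hconv⟩ := hf
  have hepi := hconv.epiConvex
  obtain ⟨x₀, a₀, h₀⟩ := hprop.exists_coe
  -- a lower bound near `x₀`
  obtain ⟨c, hc⟩ : ∃ c : ℝ, ∀ w ∈ Metric.closedBall x₀ 1, (c : EReal) ≤ f w := by
    obtain ⟨w₀, hw₀, hmin⟩ := LowerSemicontinuousOn.exists_isMinOn
      (Metric.nonempty_closedBall.2 zero_le_one) (isCompact_closedBall x₀ 1)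
      (hlsc.lowerSemicontinuousOn _)
    have hle : f w₀ ≤ a₀ := (hmin (Metric.mem_closedBall_self zero_le_one)).trans h₀.le
    obtain ⟨c, hc⟩ := exists_coe_eq hprop.1 hle
    exact ⟨c, fun w hw => hc ▸ hmin hw⟩
  have hca : c ≤ a₀ := by
    have := hc x₀ (Metric.mem_closedBall_self zero_le_one)
    rwa [h₀, EReal.coe_le_coe_iff] at this
  have hlow : ∀ (w : E) (t : ℝ), 1 < ‖w - x₀‖ → f w ≤ t →
      ‖w - x₀‖ * c - (‖w - x₀‖ - 1) * a₀ ≤ t := by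
    intro w t hρ hw
    set ρ := ‖w - x₀‖
    have hρ0 : 0 < ρ := by linarith
    have h1 := hepi w x₀ t a₀ (1 / ρ) (by positivity) (by rw [div_lt_one hρ0]; exact hρ) hw h₀.le
    have h2 : (1 / ρ) • w + (1 - 1 / ρ) • x₀ ∈ Metric.closedBall x₀ 1 := by
      rw [mem_closedBall_iff_norm]
      have : (1 / ρ) • w + (1 - 1 / ρ) • x₀ - x₀ = (1 / ρ) • (w - x₀) := by module
      rw [this, norm_smul, Real.norm_eq_abs, abs_of_pos (by positivity)]
      change 1 / ρ * ρ ≤ 1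
      rw [one_div_mul_cancel hρ0.ne']
    have h3 := EReal.coe_le_coe_iff.1 ((hc _ h2).trans h1)
    have h4 : ρ * c ≤ ρ * (1 / ρ * t + (1 - 1 / ρ) * a₀) := mul_le_mul_of_nonneg_left h3 hρ0.le
    have h5 : ρ * (1 / ρ * t + (1 - 1 / ρ) * a₀) = t + (ρ - 1) * a₀ := by field_simp
    linarith
  set r : E → ℝ := fun w => 1 / (2 * γ) * ‖x - w‖ ^ 2 with hr
  set R := 2 * ‖x - x₀‖ + 2 * γ * (a₀ - c) + 1 with hR
  have hR1 : 1 ≤ R := by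
    have : 0 ≤ 2 * γ * (a₀ - c) := mul_nonneg (by positivity) (by linarith)
    linarith [norm_nonneg (x - x₀)]
  have hlsc' : LowerSemicontinuous fun w => f w + ((r w : ℝ) : EReal) := by
    refine hlsc.add' (Continuous.lowerSemicontinuous ?_) fun w => ?_
    · exact continuous_coe_real_ereal.comp (by fun_prop)
    · exact EReal.continuousAt_add (Or.inr (EReal.coe_ne_bot _)) (Or.inr (EReal.coe_ne_top _))
  obtain ⟨p, hp, hmin⟩ := LowerSemicontinuousOn.exists_isMinOn
    (Metric.nonempty_closedBall.2 (zero_le_one.trans hR1)) (isCompact_closedBall x₀ R)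
    (hlsc'.lowerSemicontinuousOn _)
  have hmin' : ∀ w ∈ Metric.closedBall x₀ R, ∀ t : ℝ, f w ≤ t →
      f p + ((r p : ℝ) : EReal) ≤ ((t + r w : ℝ) : EReal) := fun w hw t ht =>
    (hmin hw).trans (by rw [EReal.coe_add]; exact add_le_add ht le_rfl)
  have hp₀ := hmin' x₀ (Metric.mem_closedBall_self (zero_le_one.trans hR1)) a₀ h₀.le
  obtain ⟨a, ha⟩ : ∃ a : ℝ, f p = a := by
    refine ⟨(f p).toReal, (EReal.coe_toReal (fun htop => ?_) (hprop.1 p)).symm⟩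
    rw [htop, EReal.top_add_coe] at hp₀
    exact absurd hp₀ (not_le.2 (EReal.coe_lt_top _))
  rw [ha, ← EReal.coe_add, EReal.coe_le_coe_iff] at hp₀
  have hall : ∀ (w : E) (t : ℝ), f w ≤ t → a + r p ≤ t + r w := by
    intro w t ht
    by_cases hw : w ∈ Metric.closedBall x₀ R
    · have h1 := hmin' w hw t ht
      rwa [ha, ← EReal.coe_add, EReal.coe_le_coe_iff] at h1
    · rw [mem_closedBall_iff_norm, not_le] at hw
      refine hp₀.trans ?_
      have h1 := hlow w t (hR1.trans_lt hw) ht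
      have h2 : ‖w - x₀‖ - ‖x - x₀‖ ≤ ‖x - w‖ := by
        have := norm_sub_norm_le (w - x₀) (x - x₀)
        rwa [sub_sub_sub_cancel_right, norm_sub_rev w x] at this
      have h3 : (‖w - x₀‖ - ‖x - x₀‖) ^ 2 ≤ ‖x - w‖ ^ 2 :=
        pow_le_pow_left₀ (by nlinarith [norm_nonneg (x - x₀), mul_nonneg hγ.le (sub_nonneg.2 hca)])
          h2 2
      have h4 : ‖x - x₀‖ ^ 2 + 2 * γ * (‖w - x₀‖ * (a₀ - c)) ≤ ‖x - w‖ ^ 2 := by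
        refine le_trans ?_ h3
        nlinarith [norm_nonneg (x - x₀), mul_nonneg hγ.le (sub_nonneg.2 hca)]
      have h5 : r x₀ + ‖w - x₀‖ * (a₀ - c) ≤ r w := by
        have h6 : 1 / (2 * γ) * (‖x - x₀‖ ^ 2 + 2 * γ * (‖w - x₀‖ * (a₀ - c))) ≤
            1 / (2 * γ) * ‖x - w‖ ^ 2 := mul_le_mul_of_nonneg_left h4 (by positivity)
        have h7 : 1 / (2 * γ) * (‖x - x₀‖ ^ 2 + 2 * γ * (‖w - x₀‖ * (a₀ - c))) =
            1 / (2 * γ) * ‖x - x₀‖ ^ 2 + ‖w - x₀‖ * (a₀ - c) := by field_simp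
        rw [h7] at h6
        exact h6
      nlinarith
  refine ⟨p, isSubgrad_of_min hepi hγ ha fun w t ht => ?_⟩
  have h1 := mul_le_mul_of_nonneg_left (hall w t ht) hγ.le
  have h2 : ∀ v, γ * r v = 1 / 2 * ‖x - v‖ ^ 2 := fun v => by simp only [hr]; field_simp
  rw [mul_add, mul_add, h2, h2] at h1
  exact h1

lemma conj_le_iff {f : E → EReal} (hbot : ∀ x, f x ≠ ⊥) {u : E} {s : ℝ} :
    conj f u ≤ s ↔ ∀ (x : E) (t : ℝ), f x ≤ t → inner ℝ u x - t ≤ s := by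
  rw [conj, iSup_le_iff]
  refine forall_congr' fun x => ⟨fun h t ht => ?_, fun h => ?_⟩
  · have h1 := (EReal.sub_le_sub le_rfl ht).trans h
    rw [← EReal.coe_sub, EReal.coe_le_coe_iff, real_inner_comm] at h1
    exact h1
  · rcases eq_or_ne (f x) ⊤ with htop | hfin
    · rw [htop, EReal.sub_top]
      exact bot_le
    · have hb : f x = (f x).toReal := (EReal.coe_toReal hfin (hbot x)).symm
      have h1 := h _ hb.le
      rw [hb, ← EReal.coe_sub, EReal.coe_le_coe_iff, real_inner_comm]
      exact h1

lemma conj_epiConvex {f : E → EReal} (hbot : ∀ x, f x ≠ ⊥) : EpiConvex (conj f) := by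
  intro u v s t a ha ha1 hs ht
  rw [conj_le_iff hbot] at *
  intro x b hb
  have h1 := mul_le_mul_of_nonneg_left (hs x b hb) ha.le
  have h2 := mul_le_mul_of_nonneg_left (ht x b hb) (sub_nonneg.2 ha1.le)
  simp only [inner_add_left, inner_smul_left, RCLike.conj_to_real]
  linarith

lemma conj_ne_bot {f : E → EReal} (hf : Proper f) (u : E) : conj f u ≠ ⊥ := by
  obtain ⟨x, a, ha⟩ := hf.exists_coe
  intro h
  have h1 : ((inner ℝ x u : ℝ) : EReal) - f x ≤ conj f u :=
    le_iSup (fun x : E => ((inner ℝ x u : ℝ) : EReal) - f x) x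
  rw [h, ha, ← EReal.coe_sub, le_bot_iff] at h1
  exact EReal.coe_ne_bot _ h1

/-- Equality in the Fenchel–Young inequality. -/
lemma IsSubgrad.conj {f : E → EReal} (hf : Proper f) {x u : E} (h : IsSubgrad f x u) :
    IsSubgrad (conj f) u x := by
  obtain ⟨a, ha, h⟩ := h
  have hle : GMEMI.conj f u ≤ ((inner ℝ u x - a : ℝ) : EReal) := by
    rw [conj_le_iff hf.1]
    intro w t ht
    have := h w t ht
    rw [inner_sub_right] at this
    linarith
  obtain ⟨b, hb⟩ := exists_coe_eq (conj_ne_bot hf) hle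
  have hb' : b ≤ inner ℝ u x - a := by rwa [hb, EReal.coe_le_coe_iff] at hle
  refine ⟨b, hb, fun v t ht => ?_⟩
  have h1 := (conj_le_iff hf.1).1 ht x a ha.le
  rw [inner_sub_right]
  linarith [real_inner_comm v x, real_inner_comm u x]

section FiniteDimensional

variable [FiniteDimensional ℝ E]

/-- The subdifferential of `f*` is the inverse of that of `f`. The resolvent of `∂f` supplies the
point of `∂f` from which a given point of `∂f*` cannot differ, by monotonicity. -/
lemma Gamma0.isSubgrad_conj_iff {f : E → EReal} (hf : Gamma0 f) {x u : E} :
    IsSubgrad (conj f) u x ↔ IsSubgrad f x u := by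
  refine ⟨fun h => ?_, fun h => h.conj hf.1⟩
  obtain ⟨x', h'⟩ := hf.exists_isSubgrad one_pos (x + u)
  rw [div_one, one_smul] at h'
  have h1 := h.monotone (h'.conj hf.1)
  have h2 : u - (x + u - x') = -(x - x') := by abel
  rw [h2, inner_neg_right, real_inner_self_eq_norm_sq] at h1
  have h3 : ‖x - x'‖ = 0 := by nlinarith [norm_nonneg (x - x')]
  have h4 : x = x' := sub_eq_zero.1 (norm_eq_zero.1 h3)
  rw [← h4, add_sub_cancel_left] at h'
  exact h'

lemma Gamma0.prox_scale_eq_iff {f : E → EReal} (hf : Gamma0 f) {γ : ℝ} (hγ : 0 < γ) {x p : E} :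
    prox (scale γ f) x = p ↔ IsSubgrad f p ((1 / γ) • (x - p)) :=
  GMEMI.prox_scale_eq_iff hf.1.1 hf.2.2.epiConvex hf.1.exists_coe hγ (hf.exists_isSubgrad hγ x)

/-- Moreau's identity: the proximity operator of `γ f*` in terms of subgradients of `f`. -/
lemma Gamma0.prox_scale_conj_eq_iff {f : E → EReal} (hf : Gamma0 f) {γ : ℝ} (hγ : 0 < γ)
    {x p : E} : prox (scale γ (conj f)) x = p ↔ IsSubgrad f ((1 / γ) • (x - p)) p := by
  obtain ⟨w, hw⟩ := hf.exists_isSubgrad (γ := 1 / γ) (by positivity) ((1 / γ) • x)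
  have h1 : (1 / (1 / γ)) • ((1 / γ) • x - w) = x - γ • w := by
    rw [one_div_one_div, smul_sub, smul_smul, mul_one_div_cancel hγ.ne', one_smul]
  have h2 : (1 / γ) • (x - (x - γ • w)) = w := by
    rw [sub_sub_cancel, smul_smul, one_div_mul_cancel hγ.ne', one_smul]
  rw [h1] at hw
  have h3 := hw.conj hf.1
  obtain ⟨b, hb, -⟩ := id h3
  rw [GMEMI.prox_scale_eq_iff (conj_ne_bot hf.1) (conj_epiConvex hf.1.1) ⟨_, b, hb⟩ hγ
    ⟨x - γ • w, by rwa [h2]⟩, hf.isSubgrad_conj_iff]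

lemma Gamma0.prox_conj_eq_iff {f : E → EReal} (hf : Gamma0 f) {x p : E} :
    prox (conj f) x = p ↔ IsSubgrad f (x - p) p := by
  have := hf.prox_scale_conj_eq_iff one_pos (x := x) (p := p)
  rwa [scale_one, div_one, one_smul] at this

/-- The variational characterization of the projection onto a closed convex set. -/
lemma proj_eq_iff {C : Set E} (hne : C.Nonempty) (hcl : IsClosed C) (hconv : Convex ℝ C)
    {x p : E} : proj C x = p ↔ p ∈ C ∧ ∀ w ∈ C, inner ℝ (x - p) (w - p) ≤ 0 := by
  have key : ∀ q, (q ∈ C ∧ ∀ w ∈ C, ‖x - q‖ ≤ ‖x - w‖) ↔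
      (q ∈ C ∧ ∀ w ∈ C, inner ℝ (x - q) (w - q) ≤ 0) := by
    intro q
    refine and_congr_right fun hq => ?_
    rw [← norm_eq_iInf_iff_real_inner_le_zero hconv hq]
    have : Nonempty C := hne.to_subtype
    have hbdd : BddBelow (range fun w : C => ‖x - w‖) :=
      ⟨0, by rintro _ ⟨w, rfl⟩; exact norm_nonneg _⟩
    constructor
    · intro h
      exact le_antisymm (le_ciInf fun w => h w w.2) (ciInf_le hbdd ⟨q, hq⟩)
    · intro h w hw
      rw [h]
      exact ciInf_le hbdd ⟨w, hw⟩
  obtain ⟨q, hq, hq'⟩ := exists_norm_eq_iInf_of_complete_convex hne hcl.isComplete hconv x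
  have hspec := (key (proj C x)).1 (Classical.epsilon_spec
    (p := fun p => p ∈ C ∧ ∀ w ∈ C, ‖x - p‖ ≤ ‖x - w‖)
    ⟨q, (key q).2 ⟨hq, (norm_eq_iInf_iff_real_inner_le_zero hconv hq).1 hq'⟩⟩)
  refine ⟨fun h => h ▸ hspec, fun h => ?_⟩
  have h1 := hspec.2 p h.1
  have h2 := h.2 _ hspec.1
  set p' := proj C x
  have h3 : ‖p - p'‖ ^ 2 ≤ 0 := by
    rw [← real_inner_self_eq_norm_sq]
    simp only [inner_sub_left, inner_sub_right] at *
    linarith [real_inner_comm p p']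
  have h4 : ‖p - p'‖ = 0 := by nlinarith [norm_nonneg (p - p')]
  exact (sub_eq_zero.1 (norm_eq_zero.1 h4)).symm

end FiniteDimensional

end Subgradient

/-! ### Separation under a relative interior condition -/

/-- A convex set in `F × ℝ` whose projection has `0` in its relative interior, and which lies above
`0` over the origin, lies above the graph of a linear functional. -/
theorem exists_linear_le_of_mem_intrinsicInterior {F : Type*} [NormedAddCommGroup F]
    [InnerProductSpace ℝ F] [FiniteDimensional ℝ F] {U : Set (F × ℝ)} (hconv : Convex ℝ U)
    (hri : (0 : F) ∈ intrinsicInterior ℝ (Prod.fst '' U)) (h0 : ∀ t : ℝ, ((0 : F), t) ∈ U → 0 ≤ t) :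
    ∃ ξ : F, ∀ z ∈ U, inner ℝ ξ z.1 ≤ z.2 := by
  set D := Prod.fst '' U with hD
  obtain ⟨o, ho, ho0⟩ := mem_intrinsicInterior.1 hri
  have hoA : (0 : F) ∈ affineSpan ℝ D := ho0 ▸ o.2
  obtain ⟨e₀, he₀, he₀0⟩ : (0 : F) ∈ D := intrinsicInterior_subset hri
  set S := (affineSpan ℝ D).direction with hS
  have hDS : ∀ e ∈ U, e.1 ∈ S := fun e he => by
    have := AffineSubspace.vsub_mem_direction (subset_affineSpan ℝ D (mem_image_of_mem _ he)) hoA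
    simpa using this
  -- `0` is an absorbing point of `D` inside `S`
  have habs : ∀ b ∈ S, ∃ ε : ℝ, 0 < ε ∧ ε • b ∈ D := by
    intro b hb
    have hmem : ∀ t : ℝ, t • b ∈ affineSpan ℝ D := fun t => by
      have := AffineSubspace.vadd_mem_of_mem_direction (S.smul_mem t hb) hoA
      simpa using this
    have hcont : Continuous fun t : ℝ => (⟨t • b, hmem t⟩ : affineSpan ℝ D) :=
      Continuous.subtype_mk (by fun_prop) _
    have h1 : ∀ᶠ t in 𝓝 (0 : ℝ), (⟨t • b, hmem t⟩ : affineSpan ℝ D) ∈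
        interior ((↑) ⁻¹' D : Set (affineSpan ℝ D)) := by
      refine hcont.continuousAt.eventually_mem (isOpen_interior.mem_nhds ?_)
      have : (⟨(0 : ℝ) • b, hmem 0⟩ : affineSpan ℝ D) = o := Subtype.ext (by simp [ho0])
      rwa [this]
    obtain ⟨ε, hε, hεpos⟩ := ((h1.filter_mono nhdsWithin_le_nhds).and
      (self_mem_nhdsWithin : Ioi (0 : ℝ) ∈ 𝓝[>] 0)).exists
    have h2 : (⟨ε • b, hmem ε⟩ : affineSpan ℝ D) ∈ ((↑) ⁻¹' D : Set (affineSpan ℝ D)) :=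
      interior_subset hε
    exact ⟨ε, hεpos, h2⟩
  -- the convex cone generated by `U` and the upward direction, inside `S × ℝ`
  let K : PointedCone ℝ (S × ℝ) :=
    { carrier := {z | ∃ c : ℝ, 0 ≤ c ∧ ∃ e ∈ U, c • e.1 = z.1 ∧ c * e.2 ≤ z.2}
      zero_mem' := ⟨0, le_rfl, e₀, he₀, by simp, by simp⟩
      add_mem' := by
        rintro z w ⟨c, hc, e, he, h1, h2⟩ ⟨c', hc', e', he', h1', h2'⟩
        rcases (add_nonneg hc hc').eq_or_lt with hcc | hcc
        · have hc0 : c = 0 := by linarith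
          have hc0' : c' = 0 := by linarith
          subst hc0 hc0'
          refine ⟨0, le_rfl, e, he, ?_, ?_⟩
          · simp only [zero_smul] at h1 h1' ⊢
            simp [← h1, ← h1']
          · simp only [zero_mul] at h2 h2' ⊢
            exact add_nonneg h2 h2'
        · refine ⟨c + c', hcc.le, (c / (c + c')) • e + (c' / (c + c')) • e',
            hconv he he' (by positivity) (by positivity) (by field_simp), ?_, ?_⟩
          · simp only [Prod.fst_add, Prod.smul_fst, smul_add, smul_smul, Submodule.coe_add, ← h1,
              ← h1', mul_div_cancel₀ _ hcc.ne']
          · have h3 : (c + c') * ((c / (c + c')) • e + (c' / (c + c')) • e').2 =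
                c * e.2 + c' * e'.2 := by
              simp only [Prod.snd_add, Prod.smul_snd, smul_eq_mul]
              field_simp
            rw [h3]
            exact add_le_add h2 h2'
      smul_mem' := by
        rintro ⟨a, ha⟩ z ⟨c, hc, e, he, h1, h2⟩
        refine ⟨a * c, mul_nonneg ha hc, e, he, ?_, ?_⟩
        · rw [mul_smul, h1]; rfl
        · rw [mul_assoc]; exact mul_le_mul_of_nonneg_left h2 ha }
  let φ : (S × ℝ) →ₗ.[ℝ] ℝ :=
    ⟨Submodule.prod ⊥ ⊤, (LinearMap.snd ℝ S ℝ).comp (Submodule.subtype _)⟩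
  obtain ⟨g, hg1, hg2⟩ := riesz_extension K φ
    (by
      rintro ⟨⟨b, t⟩, hb, _⟩ ⟨c, hc, e, he, h1, h2⟩
      have hb0 : b = 0 := hb
      change 0 ≤ t
      change c * e.2 ≤ t at h2
      refine le_trans ?_ h2
      rcases hc.eq_or_lt with hc0 | hc0
      · simp [← hc0]
      · have he0 : e.1 = 0 := by
          simpa [hb0, hc0.ne'] using h1
        exact mul_nonneg hc (h0 e.2 (by rw [← he0]; exact he)))
    (by
      rintro ⟨b, t⟩
      obtain ⟨ε, hε, e, he, hεb⟩ := habs b b.2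
      refine ⟨⟨(0, e.2 / ε - t), by simp [φ]⟩, ε⁻¹, by positivity, e, he, ?_, ?_⟩
      · simp [hεb, smul_smul, hε.ne']
      · change ε⁻¹ * e.2 ≤ e.2 / ε - t + t
        rw [sub_add_cancel, div_eq_inv_mul])
  have hg3 : ∀ t : ℝ, g (0, t) = t := fun t => hg1 ⟨(0, t), by simp [φ]⟩
  obtain ⟨ℓ, hℓ⟩ := LinearMap.exists_extend (-(g.comp (LinearMap.inl ℝ S ℝ)))
  refine ⟨(InnerProductSpace.toDual ℝ F).symm (LinearMap.toContinuousLinearMap ℓ), fun z hz => ?_⟩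
  rw [InnerProductSpace.toDual_symm_apply, LinearMap.coe_toContinuousLinearMap']
  have h1 : 0 ≤ g (⟨z.1, hDS z hz⟩, z.2) :=
    hg2 _ ⟨1, zero_le_one, z, hz, by simp, by simp⟩
  have h2 : g (⟨z.1, hDS z hz⟩, z.2) = g (⟨z.1, hDS z hz⟩, 0) + z.2 := by
    nth_rewrite 2 [← hg3 z.2]
    rw [← map_add]
    simp
  have h3 : ℓ z.1 = -g (⟨z.1, hDS z hz⟩, 0) := congrArg (fun k => k ⟨z.1, hDS z hz⟩) hℓ
  linarith

/-! ### Attainment of minima -/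

section Attainment

variable {E : Type*} [NormedAddCommGroup E] [InnerProductSpace ℝ E] [FiniteDimensional ℝ E]

/-- A continuous function that is bounded below attains its minimum if it is constant along every
asymptotic direction of its sublevel sets. Points of least norm in the sublevel sets near the
infimum stay bounded, since the component along such a direction could be removed. -/
theorem exists_forall_le_of_constant_directions {F : E → ℝ} (hF : Continuous F)
    (hbdd : BddBelow (range F))
    (hconst : ∀ (v : ℕ → E) (e : E) (c : ℝ), Tendsto (fun k => ‖v k‖) atTop atTop →
      Tendsto (fun k => ‖v k‖⁻¹ • v k) atTop (𝓝 e) → (∀ k, F (v k) ≤ c) →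
      ∀ (w : E) (t : ℝ), F (w + t • e) = F w) :
    ∃ v, ∀ w, F v ≤ F w := by
  set I := ⨅ w, F w with hI
  have hlow : ∀ w, I ≤ F w := fun w => ciInf_le hbdd w
  have hex : ∀ k : ℕ, ∃ v, F v ≤ I + 1 / ((k : ℝ) + 1) ∧
      ∀ w, F w ≤ I + 1 / ((k : ℝ) + 1) → ‖v‖ ≤ ‖w‖ := by
    intro k
    have hpos : 0 < 1 / ((k : ℝ) + 1) := by positivity
    obtain ⟨w₀, hw₀⟩ := exists_lt_of_ciInf_lt (show ⨅ w, F w < I + 1 / ((k : ℝ) + 1) by linarith)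
    have hcl : IsClosed {w | F w ≤ I + 1 / ((k : ℝ) + 1)} := isClosed_le hF continuous_const
    obtain ⟨v, hv, hdist⟩ := hcl.exists_infDist_eq_dist ⟨w₀, hw₀.le⟩ 0
    refine ⟨v, hv, fun w hw => ?_⟩
    have := Metric.infDist_le_dist_of_mem (x := (0 : E)) (show w ∈ {w | F w ≤ _} from hw)
    rwa [hdist, dist_zero_left, dist_zero_left] at this
  choose v hv hvmin using hex
  by_cases hinf : Tendsto (fun k => ‖v k‖) atTop atTop
  · exfalso
    obtain ⟨e, -, θ, hθ, he⟩ := tendsto_subseq_of_bounded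
      (Metric.isBounded_closedBall (x := (0 : E)) (r := 1)) (x := fun k => ‖v k‖⁻¹ • v k) (fun k => by
        rw [mem_closedBall_zero_iff, norm_smul, norm_inv, norm_norm]
        exact inv_mul_le_one)
    have hnorm := hinf.comp hθ.tendsto_atTop
    have hone : ‖e‖ = 1 := by
      refine tendsto_nhds_unique he.norm (tendsto_const_nhds.congr' ?_)
      filter_upwards [hnorm.eventually_gt_atTop 0] with k hk
      have hk' : ‖v (θ k)‖ ≠ 0 := ne_of_gt hk
      simp only [Function.comp_apply, norm_smul, norm_inv, norm_norm]
      rw [inv_mul_cancel₀ hk']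
    have hc := hconst (v ∘ θ) e (I + 1) hnorm he (fun k => (hv _).trans (by
      have : 1 / ((θ k : ℝ) + 1) ≤ 1 := by
        rw [div_le_one (by positivity)]
        linarith [Nat.cast_nonneg (α := ℝ) (θ k)]
      linarith))
    have horth : ∀ k, inner ℝ (v k) e = 0 := by
      intro k
      have h1 := hvmin k (v k + (-inner ℝ (v k) e) • e) (by rw [hc]; exact hv k)
      have h2 : ‖v k + (-inner ℝ (v k) e) • e‖ ^ 2 = ‖v k‖ ^ 2 - (inner ℝ (v k) e) ^ 2 := by
        rw [norm_add_sq_real, inner_smul_right, norm_smul, hone, Real.norm_eq_abs, mul_one, sq_abs]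
        ring
      have h3 := pow_le_pow_left₀ (norm_nonneg _) h1 2
      rw [h2] at h3
      nlinarith [sq_nonneg (inner ℝ (v k) e)]
    have hzero : inner ℝ e e = 0 := by
      refine tendsto_nhds_unique (he.inner tendsto_const_nhds)
        (tendsto_const_nhds.congr fun k => ?_)
      simp only [Function.comp_apply, inner_smul_left, horth, mul_zero]
    rw [real_inner_self_eq_norm_sq, hone] at hzero
    norm_num at hzero
  · rw [tendsto_atTop] at hinf
    push Not at hinf
    obtain ⟨b, hb⟩ := hinf
    obtain ⟨a, -, θ, hθ, ha⟩ := tendsto_subseq_of_frequently_bounded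
      (Metric.isBounded_closedBall (x := (0 : E)) (r := b)) (x := v)
      (hb.mono fun k hk => mem_closedBall_zero_iff.2 (not_le.1 (by simpa using hk)).le)
    refine ⟨a, fun w => le_trans ?_ (hlow w)⟩
    have h1 : Tendsto (fun k => I + 1 / ((θ k : ℝ) + 1)) atTop (𝓝 (I + 0)) :=
      (tendsto_const_nhds.add tendsto_one_div_add_atTop_nhds_zero_nat).comp hθ.tendsto_atTop
    rw [add_zero] at h1
    exact le_of_tendsto_of_tendsto' ((hF.tendsto a).comp ha) h1 fun k => hv (θ k)

/-- An even convex function plus a quadratic that is constant along the kernel of a linear map `B`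
attains its minimum. Evenness turns every direction of descent into a direction of constancy. -/
theorem exists_min_even_add_sq {F : Type*} [NormedAddCommGroup F] [InnerProductSpace ℝ F]
    {ψ : E → ℝ} (hψ : ConvexOn ℝ univ ψ) (heven : ∀ u, ψ (-u) = ψ u) {c₀ : ℝ}
    (hc₀ : ∀ u, c₀ ≤ ψ u) (B : E →ₗ[ℝ] F) (u : E) :
    ∃ v, ∀ w, ψ v + 1 / 2 * ‖B (u - v)‖ ^ 2 ≤ ψ w + 1 / 2 * ‖B (u - w)‖ ^ 2 := by
  have hcont : Continuous ψ := continuousOn_univ.1 (hψ.continuousOn isOpen_univ)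
  have hB : Continuous B := B.continuous_of_finiteDimensional
  apply exists_forall_le_of_constant_directions (F := fun v => ψ v + 1 / 2 * ‖B (u - v)‖ ^ 2)
    (by fun_prop)
  · exact ⟨c₀, by rintro _ ⟨v, rfl⟩; have := hc₀ v; dsimp only; nlinarith [sq_nonneg ‖B (u - v)‖]⟩
  intro v e c hv he hc
  have hinv : Tendsto (fun k => ‖v k‖⁻¹) atTop (𝓝 0) := tendsto_inv_atTop_zero.comp hv
  have hψc : ∀ k, ψ (v k) ≤ c := fun k => by
    have := hc k
    nlinarith [sq_nonneg ‖B (u - v k)‖]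
  have hBc : ∀ k, ‖B (u - v k)‖ ≤ (c - c₀) + 1 := fun k => by
    have := hc k
    nlinarith [sq_nonneg (‖B (u - v k)‖ - 1), hc₀ (v k)]
  have hBe : B e = 0 := by
    have h1 : Tendsto (fun k => ‖v k‖⁻¹ • B u - ‖v k‖⁻¹ • B (u - v k)) atTop (𝓝 0) := by
      have h2 : Tendsto (fun k => ‖v k‖⁻¹ • B u) atTop (𝓝 ((0 : ℝ) • B u)) :=
        hinv.smul_const _
      have h3 : Tendsto (fun k => ‖v k‖⁻¹ • B (u - v k)) atTop (𝓝 0) := by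
        refine squeeze_zero_norm (a := fun k => ‖v k‖⁻¹ * ((c - c₀) + 1)) (fun k => ?_)
          (by simpa using hinv.mul_const ((c - c₀) + 1))
        rw [norm_smul, norm_inv, norm_norm]
        exact mul_le_mul_of_nonneg_left (hBc k) (by positivity)
      simpa using h2.sub h3
    refine tendsto_nhds_unique ((hB.tendsto e).comp he) (h1.congr fun k => ?_)
    simp only [Function.comp_apply, map_smul, map_sub]
    module
  have hdesc : ∀ (w : E) (t : ℝ), 0 ≤ t → ψ (w + t • e) ≤ ψ w := by
    intro w t ht
    have h1 : Tendsto (fun k => (1 - t * ‖v k‖⁻¹) • w + t • (‖v k‖⁻¹ • v k)) atTop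
        (𝓝 ((1 - t * 0) • w + t • e)) :=
      ((tendsto_const_nhds.sub (hinv.const_mul t)).smul_const w).add (he.const_smul t)
    have h2 : Tendsto (fun k => (1 - t * ‖v k‖⁻¹) * ψ w + (t * ‖v k‖⁻¹) * c) atTop
        (𝓝 ((1 - t * 0) * ψ w + (t * 0) * c)) :=
      ((tendsto_const_nhds.sub (hinv.const_mul t)).mul_const _).add
        ((hinv.const_mul t).mul_const _)
    simp only [mul_zero, sub_zero, one_smul, one_mul, zero_mul, add_zero] at h1 h2
    refine le_of_tendsto_of_tendsto ((hcont.tendsto _).comp h1) h2 ?_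
    filter_upwards [hv.eventually_ge_atTop (t + 1)] with k hk
    have hpos : 0 < ‖v k‖ := by linarith
    have h3 : t * ‖v k‖⁻¹ ≤ 1 := by
      rw [← div_eq_mul_inv, div_le_one hpos]
      linarith
    have h4 := hψ.2 (mem_univ w) (mem_univ (v k)) (sub_nonneg.2 h3)
      (mul_nonneg ht (inv_nonneg.2 hpos.le)) (by ring)
    simp only [smul_eq_mul] at h4
    simp only [Function.comp_apply, smul_smul]
    exact h4.trans (by have := mul_le_mul_of_nonneg_left (hψc k)
                            (mul_nonneg ht (inv_nonneg.2 hpos.le)); linarith)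
  have hconst : ∀ (w : E) (t : ℝ), 0 ≤ t → ψ (w + t • e) = ψ w := by
    intro w t ht
    refine le_antisymm (hdesc w t ht) ?_
    have h1 := hdesc (-(w + t • e)) t ht
    rw [heven, show -(w + t • e) + t • e = -w by abel, heven] at h1
    exact h1
  intro w t
  have h1 : ψ (w + t • e) = ψ w := by
    rcases le_total 0 t with ht | ht
    · exact hconst w t ht
    · have := hconst (w + t • e) (-t) (neg_nonneg.2 ht)
      rw [neg_smul, add_neg_cancel_right] at this
      exact this.symm
  have h2 : B (u - (w + t • e)) = B (u - w) := by
    simp [map_sub, map_add, map_smul, hBe]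
  rw [h1, h2]

end Attainment

/-! ### Averaged operators in a weighted norm -/

section Averaged

variable {E : Type*} [NormedAddCommGroup E] [InnerProductSpace ℝ E]

lemma PosDefOp.nonneg {K : E →ₗ[ℝ] E} (hK : PosDefOp K) (z : E) : 0 ≤ inner ℝ z (K z) := by
  rcases eq_or_ne z 0 with rfl | hz
  · simp
  · exact (hK.2 z hz).le

/-- The inequality `‖Tz - Tw‖² + ((1 - α)/α) ‖(z - Tz) - (w - Tw)‖² ≤ ‖z - w‖²` characterizes
averaged operators; this is the implication in use. -/
theorem averagedNonexpansive_of_le {K : E →ₗ[ℝ] E} (hK : PosDefOp K) {T : E → E} {α : ℝ}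
    (hα : 0 < α) (hα1 : α < 1)
    (hT : ∀ z w, inner ℝ (T z - T w) (K (T z - T w)) + (1 - α) / α *
      inner ℝ ((z - T z) - (w - T w)) (K ((z - T z) - (w - T w))) ≤ inner ℝ (z - w) (K (z - w))) :
    AveragedNonexpansive (opWeightedNorm K) α T := by
  refine ⟨fun z w => Real.sqrt_le_sqrt ?_, hα, hα1, fun z => z + α⁻¹ • (T z - z),
    fun z w => Real.sqrt_le_sqrt ?_, fun z => ?_⟩
  · have h1 := hT z w
    have h2 : 0 ≤ (1 - α) / α * inner ℝ ((z - T z) - (w - T w)) (K ((z - T z) - (w - T w))) :=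
      mul_nonneg (div_nonneg (by linarith) hα.le) (hK.nonneg _)
    linarith
  · have h1 := hT z w
    set a := z - w
    set b := T z - T w
    have h2 : (z - T z) - (w - T w) = a - b := by simp only [a, b]; abel
    have h3 : z + α⁻¹ • (T z - z) - (w + α⁻¹ • (T w - w)) = a + α⁻¹ • (b - a) := by
      simp only [a, b]; module
    rw [h2] at h1
    rw [h3]
    have hsymm : inner ℝ b (K a) = inner ℝ a (K b) := by
      rw [← hK.1 b a, real_inner_comm]
    simp only [map_sub, map_add, map_smul, inner_sub_left, inner_sub_right, inner_add_left,
      inner_add_right, inner_smul_left, inner_smul_right, RCLike.conj_to_real, hsymm] at h1 ⊢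
    set p := inner ℝ a (K a)
    set q := inner ℝ a (K b)
    set r := inner ℝ b (K b)
    have h4 : p - (r + (1 - α) / α * (p - q - (q - r))) =
      α * (p - (p + α⁻¹ * (q - p) + (α⁻¹ * (q - p) + α⁻¹ * (α⁻¹ * (r - q - (q - p)))))) := by
      field_simp
      ring
    have h5 : 0 ≤ p - (r + (1 - α) / α * (p - q - (q - r))) := by linarith
    rw [h4] at h5
    have h6 := nonneg_of_mul_nonneg_right h5 hα
    linarith
  · rw [smul_add, smul_smul, mul_inv_cancel₀ hα.ne', one_smul]
    module

/-- A positive definite form on a finite-dimensional space dominates the squared norm. -/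
lemma PosDefOp.exists_le [FiniteDimensional ℝ E] {K : E →ₗ[ℝ] E} (hK : PosDefOp K) :
    ∃ c : ℝ, 0 < c ∧ ∀ z, c * ‖z‖ ^ 2 ≤ inner ℝ z (K z) := by
  have hcont : Continuous fun z => (inner ℝ z (K z) : ℝ) :=
    continuous_id.inner K.continuous_of_finiteDimensional
  rcases (Metric.sphere (0 : E) 1).eq_empty_or_nonempty with hemp | hne
  · refine ⟨1, one_pos, fun z => ?_⟩
    rcases eq_or_ne z 0 with rfl | hz
    · simp
    · have : (‖z‖⁻¹ • z) ∈ Metric.sphere (0 : E) 1 := by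
        rw [mem_sphere_zero_iff_norm, norm_smul, norm_inv, norm_norm,
          inv_mul_cancel₀ (norm_ne_zero_iff.2 hz)]
      rw [hemp] at this
      exact this.elim
  · obtain ⟨s, hs, hmin⟩ := (isCompact_sphere (0 : E) 1).exists_isMinOn hne hcont.continuousOn
    have hs0 : s ≠ 0 := by
      rintro rfl
      simp at hs
    refine ⟨_, hK.2 s hs0, fun z => ?_⟩
    rcases eq_or_ne z 0 with rfl | hz
    · simp
    · have hz' := norm_ne_zero_iff.2 hz
      have h1 : (‖z‖⁻¹ • z) ∈ Metric.sphere (0 : E) 1 := by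
        rw [mem_sphere_zero_iff_norm, norm_smul, norm_inv, norm_norm, inv_mul_cancel₀ hz']
      have h2 : inner ℝ s (K s) ≤ inner ℝ (‖z‖⁻¹ • z) (K (‖z‖⁻¹ • z)) := hmin h1
      rw [map_smul, inner_smul_left, inner_smul_right, RCLike.conj_to_real] at h2
      have h3 := mul_le_mul_of_nonneg_right h2 (sq_nonneg ‖z‖)
      have h4 : ‖z‖⁻¹ * (‖z‖⁻¹ * inner ℝ z (K z)) * ‖z‖ ^ 2 = inner ℝ z (K z) := by field_simp
      linarith

lemma PosDefOp.tendsto_zero [FiniteDimensional ℝ E] {K : E →ₗ[ℝ] E} (hK : PosDefOp K)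
    {ι : Type*} {l : Filter ι} {w : ι → E}
    (h : Tendsto (fun k => inner ℝ (w k) (K (w k))) l (𝓝 0)) : Tendsto w l (𝓝 0) := by
  obtain ⟨b, hb, hcoer⟩ := hK.exists_le
  rw [tendsto_zero_iff_norm_tendsto_zero]
  have h1 : Tendsto (fun k => ‖w k‖ ^ 2) l (𝓝 0) := by
    refine squeeze_zero (fun k => sq_nonneg _) (fun k => ?_)
      (g := fun k => b⁻¹ * inner ℝ (w k) (K (w k))) (by simpa using h.const_mul b⁻¹)
    rw [← div_eq_inv_mul, le_div_iff₀ hb, mul_comm]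
    exact hcoer _
  have h2 := (Real.continuous_sqrt.tendsto 0).comp h1
  simpa [Function.comp_def, Real.sqrt_sq] using h2

/-- The Krasnosel'skiĭ–Mann theorem in finite dimension: the iterates of an averaged operator with a
fixed point converge to a fixed point. -/
theorem tendsto_fixedPoint_of_averaged [FiniteDimensional ℝ E] {K : E →ₗ[ℝ] E} (hK : PosDefOp K)
    {T : E → E} {c : ℝ} (hc : 0 < c)
    (hT : ∀ z w, inner ℝ (T z - T w) (K (T z - T w)) + c *
      inner ℝ ((z - T z) - (w - T w)) (K ((z - T z) - (w - T w))) ≤ inner ℝ (z - w) (K (z - w)))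
    (hfix : (Function.fixedPoints T).Nonempty) {z : ℕ → E} (hz : ∀ k, z (k + 1) = T (z k)) :
    ∃ p ∈ Function.fixedPoints T, Tendsto z atTop (𝓝 p) := by
  obtain ⟨b, hb, hcoer⟩ := hK.exists_le
  set N : E → ℝ := fun z => inner ℝ z (K z) with hN
  have hNcont : Continuous N := continuous_id.inner K.continuous_of_finiteDimensional
  have hN0 : ∀ w, 0 ≤ N w := hK.nonneg
  have hne : ∀ z w, N (T z - T w) ≤ N (z - w) := fun z w => by
    have := hT z w
    have h2 := mul_nonneg hc.le (hN0 ((z - T z) - (w - T w)))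
    linarith
  have hTcont : Continuous T := by
    rw [continuous_iff_continuousAt]
    intro w
    rw [ContinuousAt, ← tendsto_sub_nhds_zero_iff]
    apply hK.tendsto_zero
    refine squeeze_zero (fun v => hN0 _) (fun v => hne v w) ?_
    have h1 : Tendsto (fun v => N (v - w)) (𝓝 w) (𝓝 (N (w - w))) :=
      (hNcont.comp (continuous_id.sub continuous_const)).tendsto w
    simpa [hN] using h1
  have hanti : ∀ p, T p = p → Antitone fun k => N (z k - p) := fun p hp =>
    antitone_nat_of_succ_le fun k => by
      have := hne (z k) p
      rwa [hp, ← hz] at this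
  have hconv : ∀ p, T p = p → Tendsto (fun k => N (z k - p)) atTop (𝓝 (⨅ k, N (z k - p))) :=
    fun p hp => tendsto_atTop_ciInf (hanti p hp) ⟨0, by rintro _ ⟨k, rfl⟩; exact hN0 _⟩
  obtain ⟨p, hp⟩ := hfix
  have hp : T p = p := hp
  have hres : Tendsto (fun k => z k - T (z k)) atTop (𝓝 0) := by
    apply hK.tendsto_zero
    have h1 : Tendsto (fun k => c⁻¹ * (N (z k - p) - N (z (k + 1) - p))) atTop (𝓝 0) := by
      simpa using ((hconv p hp).sub ((hconv p hp).comp (tendsto_add_atTop_nat 1))).const_mul c⁻¹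
    refine squeeze_zero (fun k => hN0 _) (fun k => ?_) h1
    rw [← div_eq_inv_mul, le_div_iff₀ hc]
    have h2 := hT (z k) p
    rw [hp, sub_self, sub_zero] at h2
    rw [hz]
    linarith
  have hbdd : ∀ k, z k ∈ Metric.closedBall p (Real.sqrt (b⁻¹ * N (z 0 - p))) := by
    intro k
    rw [mem_closedBall_iff_norm]
    apply Real.le_sqrt_of_sq_le
    rw [← div_eq_inv_mul, le_div_iff₀ hb, mul_comm]
    exact (hcoer _).trans (hanti p hp (Nat.zero_le k))
  obtain ⟨a, -, θ, hθ, ha⟩ := tendsto_subseq_of_bounded Metric.isBounded_closedBall hbdd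
  have hTa : T a = a := by
    have h1 : Tendsto (fun k => z (θ k) - T (z (θ k))) atTop (𝓝 (a - T a)) :=
      ha.sub ((hTcont.tendsto a).comp ha)
    exact (sub_eq_zero.1 (tendsto_nhds_unique h1 (hres.comp hθ.tendsto_atTop))).symm
  refine ⟨a, hTa, ?_⟩
  rw [← tendsto_sub_nhds_zero_iff]
  apply hK.tendsto_zero
  have h1 := hconv a hTa
  have h2 : Tendsto (fun k => N (z (θ k) - a)) atTop (𝓝 0) := by
    have h3 : Tendsto (fun k => N (z (θ k) - a)) atTop (𝓝 (N (a - a))) :=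
      ((hNcont.comp (continuous_id.sub continuous_const)).tendsto a).comp ha
    simpa [hN] using h3
  rwa [tendsto_nhds_unique (h1.comp hθ.tendsto_atTop) h2] at h1

end Averaged

/-! ### Matrices acting on Euclidean spaces -/

section Act

variable {a b c : ℕ}

lemma act_mul (K : Matrix (Fin a) (Fin b) ℝ) (K' : Matrix (Fin b) (Fin c) ℝ) (x : Vec c) :
    act (K * K') x = act K (act K' x) := by
  simp [act, Matrix.toLpLin_apply, Matrix.mulVec_mulVec]

lemma act_one (x : Vec a) : act (1 : Matrix (Fin a) (Fin a) ℝ) x = x := by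
  simp [act]

lemma inner_act_transpose (K : Matrix (Fin a) (Fin b) ℝ) (x : Vec b) (y : Vec a) :
    inner ℝ x (act Kᵀ y) = inner ℝ (act K x) y := by
  have h : act Kᵀ = LinearMap.adjoint (act K) := by
    rw [← Matrix.toEuclideanLin_conjTranspose_eq_adjoint,
      Matrix.conjTranspose_eq_transpose_of_trivial]
  rw [h, LinearMap.adjoint_inner_right]

lemma act_transpose_inner (K : Matrix (Fin a) (Fin b) ℝ) (x : Vec b) (y : Vec a) :
    inner ℝ (act Kᵀ y) x = inner ℝ y (act K x) := by
  rw [real_inner_comm, inner_act_transpose, real_inner_comm]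

lemma star_dotProduct_mulVec (K : Matrix (Fin a) (Fin a) ℝ) (x : Vec a) :
    star (WithLp.ofLp x) ⬝ᵥ (K *ᵥ WithLp.ofLp x) = inner ℝ x (act K x) := by
  rw [EuclideanSpace.inner_eq_star_dotProduct, dotProduct_comm]
  simp [act]

lemma posDef_iff_inner {K : Matrix (Fin a) (Fin a) ℝ} :
    K.PosDef ↔ K.IsHermitian ∧ ∀ x : Vec a, x ≠ 0 → 0 < inner ℝ x (act K x) := by
  rw [Matrix.posDef_iff_dotProduct_mulVec]
  refine and_congr_right fun _ => ⟨fun h x hx => ?_, fun h x hx => ?_⟩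
  · rw [← star_dotProduct_mulVec]
    exact h (by simpa using hx)
  · have := h (WithLp.toLp 2 x) (by simpa using hx)
    rwa [← star_dotProduct_mulVec] at this

lemma PosSemidef.inner_nonneg {K : Matrix (Fin a) (Fin a) ℝ} (hK : K.PosSemidef) (x : Vec a) :
    0 ≤ inner ℝ x (act K x) := by
  rw [← star_dotProduct_mulVec]
  exact hK.dotProduct_mulVec_nonneg _

lemma norm_act_le (K : Matrix (Fin a) (Fin b) ℝ) (x : Vec b) : ‖act K x‖ ≤ opNorm K * ‖x‖ :=
  (LinearMap.toContinuousLinearMap (act K)).le_opNorm x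

lemma opNorm_nonneg (K : Matrix (Fin a) (Fin b) ℝ) : 0 ≤ opNorm K := norm_nonneg _

lemma norm_act_transpose_le (K : Matrix (Fin a) (Fin b) ℝ) (y : Vec a) :
    ‖act Kᵀ y‖ ≤ opNorm K * ‖y‖ := by
  have h1 : ‖act Kᵀ y‖ ^ 2 ≤ opNorm K * ‖act Kᵀ y‖ * ‖y‖ := by
    rw [← real_inner_self_eq_norm_sq, inner_act_transpose]
    exact (real_inner_le_norm _ _).trans
      (mul_le_mul_of_nonneg_right (norm_act_le _ _) (norm_nonneg _))
  rcases (norm_nonneg (act Kᵀ y)).eq_or_lt with h0 | h0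
  · rw [← h0]
    exact mul_nonneg (opNorm_nonneg _) (norm_nonneg _)
  · nlinarith

lemma inner_Q {d n m q : ℕ} (A : Matrix (Fin d) (Fin n) ℝ) (L : Matrix (Fin m) (Fin n) ℝ)
    (B : Matrix (Fin q) (Fin m) ℝ) (lam : ℝ) (x w : Vec n) :
    inner ℝ x (act (Q A L B lam) w) = inner ℝ (act A x) (act A w) -
      lam * inner ℝ (act B (act L x)) (act B (act L w)) := by
  simp only [Q, act, map_sub, map_smul, LinearMap.sub_apply, LinearMap.smul_apply]
  simp only [act_mul, inner_sub_right, inner_smul_right, inner_act_transpose]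

end Act

/-! ### Step sizes and the metric -/

section Metric

variable {d n m l p q : ℕ} {A : Matrix (Fin d) (Fin n) ℝ} {L : Matrix (Fin m) (Fin n) ℝ}
  {B : Matrix (Fin q) (Fin m) ℝ} {M : Matrix (Fin p) (Fin l) ℝ} {lam κ γ₁ γ₂ γ₃ γ₄ : ℝ}

lemma StepSizes.x_pos (h : StepSizes A L B M lam κ γ₁ γ₂ γ₃ γ₄) {x : Vec n} (hx : x ≠ 0) :
    0 < 1 / γ₁ * ‖x‖ ^ 2 - κ / 2 * ‖act A x‖ ^ 2 - lam * ‖act L x‖ ^ 2 := by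
  have := (posDef_iff_inner.1 h.1).2 x hx
  simp only [act, map_sub, map_smul, LinearMap.sub_apply, LinearMap.smul_apply] at this
  simpa only [act_mul, act_one, inner_sub_right, inner_smul_right, inner_act_transpose,
    real_inner_self_eq_norm_sq] using this

lemma StepSizes.sigma_pos (h : StepSizes A L B M lam κ γ₁ γ₂ γ₃ γ₄) {σ : Vec l} (hσ : σ ≠ 0) :
    0 < 1 / γ₂ * ‖σ‖ ^ 2 - ‖σ‖ ^ 2 - ‖act M σ‖ ^ 2 := by
  have := (posDef_iff_inner.1 h.2.1).2 σ hσ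
  simp only [act, map_sub, map_smul, LinearMap.sub_apply, LinearMap.smul_apply] at this
  simpa only [act_mul, act_one, inner_sub_right, inner_smul_right, inner_act_transpose,
    real_inner_self_eq_norm_sq] using this

lemma StepSizes.zeta_pos (h : StepSizes A L B M lam κ γ₁ γ₂ γ₃ γ₄) {ζ : Vec p} (hζ : ζ ≠ 0) :
    0 < 1 / γ₄ * ‖ζ‖ ^ 2 - γ₃ * ‖act Mᵀ ζ‖ ^ 2 := by
  have := (posDef_iff_inner.1 h.2.2.2).2 ζ hζ
  simp only [act, map_sub, map_smul, LinearMap.sub_apply, LinearMap.smul_apply] at this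
  simpa only [act_mul, act_one, inner_sub_right, inner_smul_right, ← act_transpose_inner,
    real_inner_self_eq_norm_sq] using this

lemma StepSizes.v_le (h : StepSizes A L B M lam κ γ₁ γ₂ γ₃ γ₄) (hκ : 0 < κ) (v : Vec m) :
    (κ / 2 + 2 / κ) * ‖act B v‖ ^ 2 ≤ 1 / γ₃ * ‖v‖ ^ 2 := by
  have h1 : ‖act B v‖ ^ 2 ≤ opNorm B ^ 2 * ‖v‖ ^ 2 := by
    rw [← mul_pow]
    exact pow_le_pow_left₀ (norm_nonneg _) (norm_act_le B v) 2
  calc (κ / 2 + 2 / κ) * ‖act B v‖ ^ 2 ≤ (κ / 2 + 2 / κ) * (opNorm B ^ 2 * ‖v‖ ^ 2) :=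
        mul_le_mul_of_nonneg_left h1 (by positivity)
    _ = ((κ / 2 + 2 / κ) * opNorm B ^ 2) * ‖v‖ ^ 2 := by ring
    _ ≤ _ := mul_le_mul_of_nonneg_right h.2.2.1 (sq_nonneg _)

/-- The explicit step sizes are admissible. -/
theorem stepSizes_of_eq (A : Matrix (Fin d) (Fin n) ℝ) (L : Matrix (Fin m) (Fin n) ℝ)
    (B : Matrix (Fin q) (Fin m) ℝ) (M : Matrix (Fin p) (Fin l) ℝ) (lam : ℝ) (hκ : 0 < κ) {δ : ℝ}
    (hδ : 0 < δ) (h₁ : γ₁ = 1 / (opNorm ((κ / 2) • (Aᵀ * A) + lam • (Lᵀ * L)) + δ))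
    (h₂ : γ₂ = 1 / (opNorm M ^ 2 + 1 + δ)) (h₃ : γ₃ = 1 / ((κ / 2 + 2 / κ) * opNorm B ^ 2 + δ))
    (h₄ : γ₄ = 1 / (γ₃ * opNorm M ^ 2 + δ)) :
    0 < γ₁ ∧ 0 < γ₂ ∧ 0 < γ₃ ∧ 0 < γ₄ ∧ StepSizes A L B M lam κ γ₁ γ₂ γ₃ γ₄ := by
  set N := opNorm ((κ / 2) • (Aᵀ * A) + lam • (Lᵀ * L)) with hN
  have hN0 : 0 ≤ N := opNorm_nonneg _
  have hγ₁ : 0 < γ₁ := by rw [h₁]; positivity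
  have hγ₂ : 0 < γ₂ := by rw [h₂]; positivity
  have hγ₃ : 0 < γ₃ := by rw [h₃]; positivity
  have hγ₄ : 0 < γ₄ := by rw [h₄]; positivity
  refine ⟨hγ₁, hγ₂, hγ₃, hγ₄, ?_, ?_, ?_, ?_⟩
  · rw [posDef_iff_inner]
    constructor
    · simp [Matrix.IsHermitian, Matrix.transpose_sub]
    · intro x hx
      rw [sub_sub]
      simp only [act, map_sub, map_smul, LinearMap.sub_apply, LinearMap.smul_apply]
      simp only [act_one, inner_sub_right, inner_smul_right, real_inner_self_eq_norm_sq, h₁,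
        one_div_one_div]
      have h5 := (real_inner_le_norm x (act ((κ / 2) • (Aᵀ * A) + lam • (Lᵀ * L)) x)).trans
        (mul_le_mul_of_nonneg_left (norm_act_le _ x) (norm_nonneg x))
      have h6 : 0 < ‖x‖ ^ 2 := by positivity
      rw [← hN] at h5
      nlinarith
  · rw [posDef_iff_inner]
    constructor
    · simp [Matrix.IsHermitian, Matrix.transpose_sub]
    · intro x hx
      simp only [act, map_sub, map_smul, LinearMap.sub_apply, LinearMap.smul_apply]
      simp only [act_mul, act_one, inner_sub_right, inner_smul_right, inner_act_transpose,
        real_inner_self_eq_norm_sq, h₂, one_div_one_div]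
      have h5 := pow_le_pow_left₀ (norm_nonneg _) (norm_act_le M x) 2
      have h6 : 0 < ‖x‖ ^ 2 := by positivity
      nlinarith
  · rw [h₃, one_div_one_div]
    linarith
  · rw [posDef_iff_inner]
    constructor
    · simp [Matrix.IsHermitian, Matrix.transpose_sub]
    · intro x hx
      simp only [act, map_sub, map_smul, LinearMap.sub_apply, LinearMap.smul_apply]
      simp only [act_mul, act_one, inner_sub_right, inner_smul_right, ← act_transpose_inner,
        real_inner_self_eq_norm_sq, h₄, one_div_one_div]
      have h5 := pow_le_pow_left₀ (norm_nonneg _) (norm_act_transpose_le M x) 2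
      have h6 : 0 < ‖x‖ ^ 2 := by positivity
      nlinarith

lemma inner_blocks (z w : H n l m p) : inner ℝ z w = inner ℝ (bx z) (bx w) +
    inner ℝ (bσ z) (bσ w) + inner ℝ (bv z) (bv w) + inner ℝ (bτ z) (bτ w) + inner ℝ (br z) (br w) +
    inner ℝ (bη z) (bη w) + inner ℝ (bξ z) (bξ w) + inner ℝ (bζ z) (bζ w) := by
  simp only [WithLp.prod_inner_apply, bx, bσ, bv, bτ, br, bη, bξ, bζ, WithLp.fst, WithLp.snd]
  ring

lemma inner_P (w z : H n l m p) : inner ℝ w (P L B M lam γ₁ γ₂ γ₃ γ₄ z) =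
    1 / γ₁ * inner ℝ (bx w) (bx z) - lam * inner ℝ (act B (act L (bx w))) (act B (bv z))
      - lam * inner ℝ (act L (bx w)) (br z)
    + (lam / γ₂ * inner ℝ (bσ w) (bσ z) - lam * inner ℝ (bσ w) (bη z)
      - lam * inner ℝ (act M (bσ w)) (bξ z))
    + (lam / γ₃ * inner ℝ (bv w) (bv z) - lam * inner ℝ (act B (bv w)) (act B (act L (bx z))))
    + (lam / γ₃ * inner ℝ (bτ w) (bτ z) - lam * inner ℝ (act M (bτ w)) (bζ z))
    + (lam * inner ℝ (br w) (br z) - lam * inner ℝ (br w) (act L (bx z)))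
    + (lam * inner ℝ (bη w) (bη z) - lam * inner ℝ (bη w) (bσ z))
    + (lam * inner ℝ (bξ w) (bξ z) - lam * inner ℝ (bξ w) (act M (bσ z)))
    + (lam / γ₄ * inner ℝ (bζ w) (bζ z) - lam * inner ℝ (bζ w) (act M (bτ z))) := by
  have h : P L B M lam γ₁ γ₂ γ₃ γ₄ z = mk
    ((1 / γ₁) • bx z - lam • act (Lᵀ * Bᵀ * B) (bv z) - lam • act Lᵀ (br z))
    ((lam / γ₂) • bσ z - lam • bη z - lam • act Mᵀ (bξ z))
    ((lam / γ₃) • bv z - lam • act (Bᵀ * B * L) (bx z))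
    ((lam / γ₃) • bτ z - lam • act Mᵀ (bζ z))
    (lam • br z - lam • act L (bx z))
    (lam • bη z - lam • bσ z)
    (lam • bξ z - lam • act M (bσ z))
    ((lam / γ₄) • bζ z - lam • act M (bτ z)) := rfl
  rw [inner_blocks, h]
  simp only [mk, bx, bσ, bv, bτ, br, bη, bξ, bζ, WithLp.fst, WithLp.snd]
  simp only [act_mul, inner_sub_right, inner_smul_right, inner_act_transpose]

lemma P_isSymmetric : (P L B M lam γ₁ γ₂ γ₃ γ₄).IsSymmetric := by
  intro z w
  rw [real_inner_comm, inner_P, inner_P, real_inner_comm (bx w) (bx z),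
    real_inner_comm (bσ w) (bσ z), real_inner_comm (bv w) (bv z), real_inner_comm (bτ w) (bτ z),
    real_inner_comm (br w) (br z), real_inner_comm (bη w) (bη z), real_inner_comm (bξ w) (bξ z),
    real_inner_comm (bζ w) (bζ z), real_inner_comm (act B (bv w)) (act B (act L (bx z))),
    real_inner_comm (br w) (act L (bx z)), real_inner_comm (bη w) (bσ z),
    real_inner_comm (bξ w) (act M (bσ z)), real_inner_comm (bζ w) (act M (bτ z)),
    real_inner_comm (act B (act L (bx w))) (act B (bv z)), real_inner_comm (act L (bx w)) (br z),
    real_inner_comm (bσ w) (bη z), real_inner_comm (act M (bσ w)) (bξ z),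
    real_inner_comm (act M (bτ w)) (bζ z)]
  ring

/-- The quadratic form of `P` minus `κ/2` times that of `diag(Q, 0, λ BᵀB, 0, …, 0)`, as a sum of
squares and of the forms in the step-size condition. -/
lemma inner_P_self_sub (hκ : 0 < κ) (hγ₃ : 0 < γ₃) (z : H n l m p) :
    inner ℝ z (P L B M lam γ₁ γ₂ γ₃ γ₄ z) -
      κ / 2 * (inner ℝ (bx z) (act (Q A L B lam) (bx z)) + lam * ‖act B (bv z)‖ ^ 2) =
    (1 / γ₁ * ‖bx z‖ ^ 2 - κ / 2 * ‖act A (bx z)‖ ^ 2 - lam * ‖act L (bx z)‖ ^ 2)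
    + lam * ‖br z - act L (bx z)‖ ^ 2
    + lam * (1 / γ₃ * ‖bv z‖ ^ 2 - (κ / 2 + 2 / κ) * ‖act B (bv z)‖ ^ 2)
    + lam * (κ / 2) * ‖act B (act L (bx z)) - (2 / κ) • act B (bv z)‖ ^ 2
    + lam * (1 / γ₂ * ‖bσ z‖ ^ 2 - ‖bσ z‖ ^ 2 - ‖act M (bσ z)‖ ^ 2)
    + lam * ‖bη z - bσ z‖ ^ 2 + lam * ‖bξ z - act M (bσ z)‖ ^ 2
    + lam * γ₃ * ‖(1 / γ₃) • bτ z - act Mᵀ (bζ z)‖ ^ 2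
    + lam * (1 / γ₄ * ‖bζ z‖ ^ 2 - γ₃ * ‖act Mᵀ (bζ z)‖ ^ 2) := by
  rw [inner_P, inner_Q]
  simp only [norm_sub_sq_real, norm_smul, inner_smul_left, inner_smul_right, inner_act_transpose,
    RCLike.conj_to_real, Real.norm_eq_abs, mul_pow, sq_abs, real_inner_self_eq_norm_sq]
  rw [real_inner_comm (act B (act L (bx z))) (act B (bv z)),
    real_inner_comm (act L (bx z)) (br z), real_inner_comm (bσ z) (bη z),
    real_inner_comm (act M (bσ z)) (bξ z), real_inner_comm (act M (bτ z)) (bζ z)]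
  field_simp
  ring

theorem P_posDefOp (h : StepSizes A L B M lam κ γ₁ γ₂ γ₃ γ₄) (hκ : 0 < κ) (hlam : 0 < lam)
    (hγ₃ : 0 < γ₃) (hQ : (Q A L B lam).PosSemidef) :
    PosDefOp (P L B M lam γ₁ γ₂ γ₃ γ₄ : H n l m p →ₗ[ℝ] H n l m p) ∧ ∀ z : H n l m p,
      κ / 2 * (inner ℝ (bx z) (act (Q A L B lam) (bx z)) + lam * ‖act B (bv z)‖ ^ 2) ≤
        inner ℝ z (P L B M lam γ₁ γ₂ γ₃ γ₄ z) := by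
  have hx : ∀ x : Vec n,
      0 ≤ 1 / γ₁ * ‖x‖ ^ 2 - κ / 2 * ‖act A x‖ ^ 2 - lam * ‖act L x‖ ^ 2 := fun x => by
    rcases eq_or_ne x 0 with rfl | h0
    · simp
    · exact (h.x_pos h0).le
  have hσ : ∀ σ : Vec l, 0 ≤ 1 / γ₂ * ‖σ‖ ^ 2 - ‖σ‖ ^ 2 - ‖act M σ‖ ^ 2 := fun σ => by
    rcases eq_or_ne σ 0 with rfl | h0
    · simp
    · exact (h.sigma_pos h0).le
  have hζ : ∀ ζ : Vec p, 0 ≤ 1 / γ₄ * ‖ζ‖ ^ 2 - γ₃ * ‖act Mᵀ ζ‖ ^ 2 := fun ζ => by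
    rcases eq_or_ne ζ 0 with rfl | h0
    · simp
    · exact (h.zeta_pos h0).le
  have hv : ∀ v : Vec m, 0 ≤ 1 / γ₃ * ‖v‖ ^ 2 - (κ / 2 + 2 / κ) * ‖act B v‖ ^ 2 := fun v =>
    sub_nonneg.2 (h.v_le hκ v)
  have hle : ∀ z : H n l m p,
      κ / 2 * (inner ℝ (bx z) (act (Q A L B lam) (bx z)) + lam * ‖act B (bv z)‖ ^ 2) ≤
        inner ℝ z (P L B M lam γ₁ γ₂ γ₃ γ₄ z) := fun z => by
    rw [← sub_nonneg, inner_P_self_sub hκ hγ₃]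
    have := hx (bx z)
    have := hσ (bσ z)
    have := hv (bv z)
    have := hζ (bζ z)
    positivity
  refine ⟨⟨P_isSymmetric, fun z hz => ?_⟩, hle⟩
  have hform := inner_P_self_sub (A := A) (L := L) (B := B) (M := M) (lam := lam) (γ₁ := γ₁)
    (γ₂ := γ₂) (γ₄ := γ₄) hκ hγ₃ z
  have e1 := hx (bx z)
  have e2 : 0 ≤ lam * ‖br z - act L (bx z)‖ ^ 2 := by positivity
  have e3 := mul_nonneg hlam.le (hv (bv z))
  have e4 : 0 ≤ lam * (κ / 2) * ‖act B (act L (bx z)) - (2 / κ) • act B (bv z)‖ ^ 2 := by positivity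
  have e5 := mul_nonneg hlam.le (hσ (bσ z))
  have e6 : 0 ≤ lam * ‖bη z - bσ z‖ ^ 2 := by positivity
  have e7 : 0 ≤ lam * ‖bξ z - act M (bσ z)‖ ^ 2 := by positivity
  have e8 : 0 ≤ lam * γ₃ * ‖(1 / γ₃) • bτ z - act Mᵀ (bζ z)‖ ^ 2 := by positivity
  have e9 := mul_nonneg hlam.le (hζ (bζ z))
  have e10 : 0 ≤ κ / 2 * (inner ℝ (bx z) (act (Q A L B lam) (bx z)) + lam * ‖act B (bv z)‖ ^ 2) :=
    mul_nonneg (by positivity) (add_nonneg (PosSemidef.inner_nonneg hQ _) (by positivity))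
  by_contra! hneg
  -- all the nonnegative terms vanish, and with them the blocks of `z`, one after the other
  have hx0 : bx z = 0 := by
    by_contra h0
    linarith [h.x_pos h0]
  have hσ0 : bσ z = 0 := by
    by_contra h0
    linarith [mul_pos hlam (h.sigma_pos h0)]
  have hζ0 : bζ z = 0 := by
    by_contra h0
    linarith [mul_pos hlam (h.zeta_pos h0)]
  have hvan : ∀ {k : ℕ} (c : ℝ) (u : Vec k), 0 < c → c * ‖u‖ ^ 2 ≤ 0 → u = 0 := by
    intro k c u hc hu
    by_contra h0
    have : 0 < c * ‖u‖ ^ 2 := by positivity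
    linarith
  have hr0 : br z = 0 := by
    have := hvan lam (br z - act L (bx z)) hlam (by linarith)
    simpa [hx0] using this
  have hη0 : bη z = 0 := by
    have := hvan lam (bη z - bσ z) hlam (by linarith)
    simpa [hσ0] using this
  have hξ0 : bξ z = 0 := by
    have := hvan lam (bξ z - act M (bσ z)) hlam (by linarith)
    simpa [hσ0] using this
  have hτ0 : bτ z = 0 := by
    have := hvan (lam * γ₃) ((1 / γ₃) • bτ z - act Mᵀ (bζ z)) (by positivity) (by linarith)
    simpa [hζ0, hγ₃.ne'] using this
  have hv0 : bv z = 0 := by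
    apply hvan (lam / γ₃) (bv z) (by positivity)
    have := inner_P (L := L) (B := B) (M := M) (lam := lam) (γ₁ := γ₁) (γ₂ := γ₂) (γ₃ := γ₃)
      (γ₄ := γ₄) z z
    simp only [hx0, hσ0, hζ0, hr0, hη0, hξ0, hτ0, map_zero, inner_zero_left, inner_zero_right,
      mul_zero, real_inner_self_eq_norm_sq] at this
    linarith
  apply hz
  change mk (bx z) (bσ z) (bv z) (bτ z) (br z) (bη z) (bξ z) (bζ z) = 0
  rw [hx0, hσ0, hζ0, hr0, hη0, hξ0, hτ0, hv0]
  rfl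

end Metric

/-! ### The operator as a forward-backward step -/

section Step

variable {d n m l p q : ℕ}

/-- The relation between `z` and `w = T z` written with normal cones and subgradients: the
inclusion `P (z - w) ∈ 𝒜 w + F z`, block by block, with `𝒜` monotone and `F` affine. -/
structure StepRel (A : Matrix (Fin d) (Fin n) ℝ) (y : Vec d) (L : Matrix (Fin m) (Fin n) ℝ)
    (B : Matrix (Fin q) (Fin m) ℝ) (M : Matrix (Fin p) (Fin l) ℝ) (lam : ℝ) (C : Set (Vec n))
    (f : Pair m l → EReal) (g : Vec p → EReal) (γ₁ γ₂ γ₃ γ₄ : ℝ) (z w : H n l m p) : Prop where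
  mem : bx w ∈ C
  normal : ∀ c ∈ C, inner ℝ ((1 / γ₁) • (bx z - bx w) - (act (Q A L B lam) (bx z) - act Aᵀ y
    + lam • act (Lᵀ * Bᵀ * B) (bv z) + lam • act Lᵀ (br z))) (c - bx w) ≤ 0
  sigma : (1 / γ₂) • (bσ z - bσ w) = bη z + act Mᵀ (bξ z)
  sub_v : IsSubgrad f (pair (bv w) (bτ w))
    (pair ((1 / γ₃) • (bv z - bv w) + act (Bᵀ * B) (act L ((2 : ℝ) • bx w - bx z) - bv z))
      ((1 / γ₃) • (bτ z - bτ w) - act Mᵀ (bζ z)))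
  sub_r : IsSubgrad f (pair (br z - br w + act L ((2 : ℝ) • bx w - bx z))
    (bη z - bη w + ((2 : ℝ) • bσ w - bσ z))) (pair (br w) (bη w))
  sub_xi : IsSubgrad g (bξ z - bξ w + act M ((2 : ℝ) • bσ w - bσ z)) (bξ w)
  sub_zeta : IsSubgrad g ((1 / γ₄) • (bζ z - bζ w) + act M ((2 : ℝ) • bτ w - bτ z)) (bζ w)

variable {A : Matrix (Fin d) (Fin n) ℝ} {y : Vec d} {L : Matrix (Fin m) (Fin n) ℝ}
  {B : Matrix (Fin q) (Fin m) ℝ} {M : Matrix (Fin p) (Fin l) ℝ} {lam : ℝ} {C : Set (Vec n)}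
  {f : Pair m l → EReal} {g : Vec p → EReal} {κ γ₁ γ₂ γ₃ γ₄ : ℝ}

lemma mk_eq_iff {x : Vec n} {σ : Vec l} {v : Vec m} {τ : Vec l} {r : Vec m} {η : Vec l}
    {ξ ζ : Vec p} {w : H n l m p} : mk x σ v τ r η ξ ζ = w ↔ x = bx w ∧ σ = bσ w ∧
      pair v τ = pair (bv w) (bτ w) ∧ pair r η = pair (br w) (bη w) ∧ ξ = bξ w ∧ ζ = bζ w := by
  constructor
  · rintro rfl
    exact ⟨rfl, rfl, rfl, rfl, rfl, rfl⟩
  · rintro ⟨rfl, rfl, h1, h2, rfl, rfl⟩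
    have e1 : v = bv w := congrArg WithLp.fst h1
    have e2 : τ = bτ w := congrArg WithLp.snd h1
    have e3 : r = br w := congrArg WithLp.fst h2
    have e4 : η = bη w := congrArg WithLp.snd h2
    rw [e1, e2, e3, e4]
    rfl

theorem T_eq_iff (hCne : C.Nonempty) (hCcl : IsClosed C) (hCconv : Convex ℝ C)
    (hf : Gamma0 f) (hg : Gamma0 g) (hγ₁ : 0 < γ₁) (hγ₂ : 0 < γ₂) (hγ₃ : 0 < γ₃) (hγ₄ : 0 < γ₄)
    {z w : H n l m p} : T A y L B M lam C f g γ₁ γ₂ γ₃ γ₄ z = w ↔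
      StepRel A y L B M lam C f g γ₁ γ₂ γ₃ γ₄ z w := by
  -- `T z = w` with the new blocks on the right-hand sides already replaced by those of `w`
  have hblocks : T A y L B M lam C f g γ₁ γ₂ γ₃ γ₄ z = w ↔
      proj C (bx z - γ₁ • (act (Q A L B lam) (bx z) - act Aᵀ y
        + lam • act (Lᵀ * Bᵀ * B) (bv z) + lam • act Lᵀ (br z))) = bx w ∧
      bσ z - γ₂ • (bη z + act Mᵀ (bξ z)) = bσ w ∧
      prox (scale γ₃ f)
        (pair (bv z + γ₃ • act (Bᵀ * B) (act L ((2 : ℝ) • bx w - bx z) - bv z))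
          (bτ z - γ₃ • act Mᵀ (bζ z))) = pair (bv w) (bτ w) ∧
      prox (conj f) (pair (br z + act L ((2 : ℝ) • bx w - bx z))
        (bη z + (2 : ℝ) • bσ w - bσ z)) = pair (br w) (bη w) ∧
      prox (conj g) (bξ z + act M ((2 : ℝ) • bσ w - bσ z)) = bξ w ∧
      prox (scale γ₄ (conj g)) (bζ z + γ₄ • act M ((2 : ℝ) • bτ w - bτ z)) = bζ w := by
    constructor
    · intro h
      rw [T, mk_eq_iff] at h
      obtain ⟨h1, h2, h3, h4, h5, h6⟩ := h
      rw [h1] at h3 h4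
      rw [h2] at h4 h5
      have h7 : (prox (scale γ₃ f) (pair (bv z + γ₃ • act (Bᵀ * B)
          (act L ((2 : ℝ) • bx w - bx z) - bv z)) (bτ z - γ₃ • act Mᵀ (bζ z)))).snd = bτ w :=
        congrArg WithLp.snd h3
      rw [h1] at h6
      rw [h7] at h6
      exact ⟨h1, h2, h3, h4, h5, h6⟩
    · rintro ⟨h1, h2, h3, h4, h5, h6⟩
      rw [T, mk_eq_iff]
      rw [h1, h2]
      exact ⟨rfl, rfl, h3, h4, h5, by rw [h3]; exact h6⟩
  rw [hblocks, proj_eq_iff hCne hCcl hCconv, hf.prox_scale_eq_iff hγ₃, hf.prox_conj_eq_iff,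
    hg.prox_conj_eq_iff, hg.prox_scale_conj_eq_iff hγ₄]
  have e1 : bx z - γ₁ • (act (Q A L B lam) (bx z) - act Aᵀ y
        + lam • act (Lᵀ * Bᵀ * B) (bv z) + lam • act Lᵀ (br z)) - bx w =
      γ₁ • ((1 / γ₁) • (bx z - bx w) - (act (Q A L B lam) (bx z) - act Aᵀ y
        + lam • act (Lᵀ * Bᵀ * B) (bv z) + lam • act Lᵀ (br z))) := by
    rw [smul_sub γ₁, smul_smul, mul_one_div_cancel hγ₁.ne', one_smul]
    abel
  have e2 : (bσ z - γ₂ • (bη z + act Mᵀ (bξ z)) = bσ w) ↔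
      (1 / γ₂) • (bσ z - bσ w) = bη z + act Mᵀ (bξ z) := by
    rw [sub_eq_iff_eq_add, ← sub_eq_iff_eq_add', one_div, inv_smul_eq_iff₀ hγ₂.ne']
  have e3 : (1 / γ₃) • (pair (bv z + γ₃ • act (Bᵀ * B) (act L ((2 : ℝ) • bx w - bx z) - bv z))
          (bτ z - γ₃ • act Mᵀ (bζ z)) - pair (bv w) (bτ w)) =
      pair ((1 / γ₃) • (bv z - bv w) + act (Bᵀ * B) (act L ((2 : ℝ) • bx w - bx z) - bv z))
        ((1 / γ₃) • (bτ z - bτ w) - act Mᵀ (bζ z)) := by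
    have e : ∀ {k : ℕ} (a b c : Vec k),
        (1 / γ₃) • (a + γ₃ • b - c) = (1 / γ₃) • (a - c) + b := fun a b c => by
      rw [add_sub_right_comm, smul_add, smul_smul, one_div_mul_cancel hγ₃.ne', one_smul]
    have e' := e (bτ z) (-act Mᵀ (bζ z)) (bτ w)
    rw [smul_neg, ← sub_eq_add_neg, ← sub_eq_add_neg] at e'
    rw [← e, ← e']
    rfl
  have e4 : pair (br z + act L ((2 : ℝ) • bx w - bx z)) (bη z + (2 : ℝ) • bσ w - bσ z)
        - pair (br w) (bη w) =
      pair (br z - br w + act L ((2 : ℝ) • bx w - bx z))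
        (bη z - bη w + ((2 : ℝ) • bσ w - bσ z)) := by
    have ea : br z - br w + act L ((2 : ℝ) • bx w - bx z) =
      br z + act L ((2 : ℝ) • bx w - bx z) - br w := by abel
    have eb : bη z - bη w + ((2 : ℝ) • bσ w - bσ z) = bη z + (2 : ℝ) • bσ w - bσ z - bη w := by
      abel
    rw [ea, eb]
    rfl
  have e5 : bξ z + act M ((2 : ℝ) • bσ w - bσ z) - bξ w =
      bξ z - bξ w + act M ((2 : ℝ) • bσ w - bσ z) := by abel
  have e6 : (1 / γ₄) • (bζ z + γ₄ • act M ((2 : ℝ) • bτ w - bτ z) - bζ w) =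
      (1 / γ₄) • (bζ z - bζ w) + act M ((2 : ℝ) • bτ w - bτ z) := by
    rw [add_sub_right_comm, smul_add, smul_smul, one_div_mul_cancel hγ₄.ne', one_smul]
  rw [e1, e2, e3, e4, e5, e6]
  have e7 : ∀ u v : Vec n, inner ℝ (γ₁ • u) v ≤ 0 ↔ inner ℝ u v ≤ 0 := fun u v => by
    rw [inner_smul_left, RCLike.conj_to_real, mul_nonpos_iff_pos_imp_nonpos]
    exact ⟨fun h => h.1 hγ₁, fun h => ⟨fun _ => h, fun _ => hγ₁.le⟩⟩
  simp only [e7]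
  constructor
  · rintro ⟨⟨h0, h1⟩, h2, h3, h4, h5, h6⟩
    exact ⟨h0, h1, h2, h3, h4, h5, h6⟩
  · rintro ⟨h0, h1, h2, h3, h4, h5, h6⟩
    exact ⟨⟨h0, h1⟩, h2, h3, h4, h5, h6⟩

/-- Monotonicity of the subgradients of a function on a product, in terms of the components. -/
lemma IsSubgrad.monotone_pair {f : Pair m l → EReal} {u u' a a' : Vec m} {s s' b b' : Vec l}
    (h : IsSubgrad f (pair u s) (pair a b)) (h' : IsSubgrad f (pair u' s') (pair a' b')) :
    0 ≤ inner ℝ (u - u') (a - a') + inner ℝ (s - s') (b - b') := by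
  have := h.monotone h'
  rw [real_inner_comm, WithLp.prod_inner_apply] at this
  exact this

/-- Monotonicity of `𝒜` along two steps: the skew-symmetric coupling terms cancel. -/
theorem StepRel.monotone (hlam : 0 < lam) {z z' w w' : H n l m p}
    (h : StepRel A y L B M lam C f g γ₁ γ₂ γ₃ γ₄ z w)
    (h' : StepRel A y L B M lam C f g γ₁ γ₂ γ₃ γ₄ z' w') :
    inner ℝ (bx (w - w')) (act (Q A L B lam) (bx (z - z'))) +
        lam * inner ℝ (act B (bv (w - w'))) (act B (bv (z - z'))) ≤
      inner ℝ (w - w') (P L B M lam γ₁ γ₂ γ₃ γ₄ ((z - z') - (w - w'))) := by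
  have h1 := h.normal _ h'.mem
  have h1' := h'.normal _ h.mem
  have h2 : inner ℝ (bσ w - bσ w') ((1 / γ₂) • (bσ z - bσ w)) =
    inner ℝ (bσ w - bσ w') (bη z + act Mᵀ (bξ z)) := by rw [h.sigma]
  have h2' : inner ℝ (bσ w - bσ w') ((1 / γ₂) • (bσ z' - bσ w')) =
    inner ℝ (bσ w - bσ w') (bη z' + act Mᵀ (bξ z')) := by rw [h'.sigma]
  have h3 := h.sub_v.monotone_pair h'.sub_v
  have h4 := h.sub_r.monotone_pair h'.sub_r
  have h5 := h.sub_xi.monotone h'.sub_xi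
  have h6 := h.sub_zeta.monotone h'.sub_zeta
  rw [real_inner_comm] at h1 h1'
  have hb : ∀ a b : H n l m p, bx (a - b) = bx a - bx b ∧ bσ (a - b) = bσ a - bσ b ∧
      bv (a - b) = bv a - bv b ∧ bτ (a - b) = bτ a - bτ b ∧ br (a - b) = br a - br b ∧
      bη (a - b) = bη a - bη b ∧ bξ (a - b) = bξ a - bξ b ∧ bζ (a - b) = bζ a - bζ b :=
    fun a b => ⟨rfl, rfl, rfl, rfl, rfl, rfl, rfl, rfl⟩
  rw [inner_P]
  -- everything is expressed by the blocks of `D = z - z'` and `E = w - w'`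
  obtain ⟨a1, a2, a3, a4, a5, a6, a7, a8⟩ := hb z z'
  obtain ⟨b1, b2, b3, b4, b5, b6, b7, b8⟩ := hb w w'
  obtain ⟨c1, c2, c3, c4, c5, c6, c7, c8⟩ := hb (z - z') (w - w')
  set D := z - z'
  set E := w - w'
  rw [c1, c2, c3, c4, c5, c6, c7, c8]
  have k1 : 0 ≤ inner ℝ (bx E) ((1 / γ₁) • (bx D - bx E) - (act (Q A L B lam) (bx D)
      + lam • act (Lᵀ * Bᵀ * B) (bv D) + lam • act Lᵀ (br D))) := by
    rw [a1, a3, a5, b1]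
    have e1 : bx w' - bx w = -(bx w - bx w') := by abel
    rw [e1, inner_neg_left] at h1
    have e2 : (1 / γ₁) • ((bx z - bx z') - (bx w - bx w')) - (act (Q A L B lam) (bx z - bx z')
      + lam • act (Lᵀ * Bᵀ * B) (bv z - bv z') + lam • act Lᵀ (br z - br z')) =
      ((1 / γ₁) • (bx z - bx w) - (act (Q A L B lam) (bx z) - act Aᵀ y
        + lam • act (Lᵀ * Bᵀ * B) (bv z) + lam • act Lᵀ (br z))) -
      ((1 / γ₁) • (bx z' - bx w') - (act (Q A L B lam) (bx z') - act Aᵀ y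
        + lam • act (Lᵀ * Bᵀ * B) (bv z') + lam • act Lᵀ (br z'))) := by
      simp only [map_sub]
      module
    rw [e2, inner_sub_right]
    rw [real_inner_comm] at h1'
    linarith [real_inner_comm (bx w - bx w') ((1 / γ₁) • (bx z' - bx w') - (act (Q A L B lam)
      (bx z') - act Aᵀ y + lam • act (Lᵀ * Bᵀ * B) (bv z') + lam • act Lᵀ (br z')))]
  have k2 : inner ℝ (bσ E) ((1 / γ₂) • (bσ D - bσ E)) =
      inner ℝ (bσ E) (bη D + act Mᵀ (bξ D)) := by
    rw [a2, a6, a7, b2]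
    simp only [map_sub, inner_sub_right, inner_add_right, inner_smul_right] at h2 h2' ⊢
    linarith
  have k3 : 0 ≤ inner ℝ (bv E)
        ((1 / γ₃) • (bv D - bv E) + act (Bᵀ * B) (act L ((2 : ℝ) • bx E - bx D) - bv D))
      + inner ℝ (bτ E) ((1 / γ₃) • (bτ D - bτ E) - act Mᵀ (bζ D)) := by
    rw [a1, a3, a4, a8, b1, b3, b4]
    refine h3.trans (le_of_eq ?_)
    congr 2
    · simp only [map_sub, map_smul]
      module
    · simp only [map_sub]
      module
  have k4 : 0 ≤ inner ℝ (br E) (br D - br E + act L ((2 : ℝ) • bx E - bx D)) +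
      inner ℝ (bη E) (bη D - bη E + ((2 : ℝ) • bσ E - bσ D)) := by
    rw [a1, a2, a5, a6, b1, b2, b5, b6]
    rw [real_inner_comm (br w - br w'), real_inner_comm (bη w - bη w')] at h4
    refine h4.trans (le_of_eq ?_)
    congr 2
    · simp only [map_sub, map_smul]
      module
    · module
  have k5 : 0 ≤ inner ℝ (bξ E) (bξ D - bξ E + act M ((2 : ℝ) • bσ E - bσ D)) := by
    rw [a2, a7, b2, b7]
    refine h5.trans (le_of_eq ?_)
    congr 1
    simp only [map_sub, map_smul]
    module
  have k6 : 0 ≤ inner ℝ (bζ E) ((1 / γ₄) • (bζ D - bζ E) + act M ((2 : ℝ) • bτ E - bτ D)) := by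
    rw [a4, a8, b4, b8]
    refine h6.trans (le_of_eq ?_)
    congr 1
    simp only [map_sub, map_smul]
    module
  clear h1 h1' h2 h2' h3 h4 h5 h6
  have k3' := mul_nonneg hlam.le k3
  have k4' := mul_nonneg hlam.le k4
  have k5' := mul_nonneg hlam.le k5
  have k6' := mul_nonneg hlam.le k6
  have k2' := congrArg (lam * ·) k2
  simp only [act_mul, map_sub, map_smul, inner_sub_right, inner_add_right, inner_smul_right,
    inner_act_transpose] at k1 k2' k3' k4' k5' k6' ⊢
  rw [real_inner_comm (act B (bv E)) (act B (act L (bx E))), real_inner_comm (br E) (act L (bx E)),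
    real_inner_comm (bη E) (bσ E), real_inner_comm (bξ E) (act M (bσ E)),
    real_inner_comm (bζ E) (act M (bτ E))]
  have g2 : lam / γ₂ = lam * (1 / γ₂) := by ring
  have g3 : lam / γ₃ = lam * (1 / γ₃) := by ring
  have g4 : lam / γ₄ = lam * (1 / γ₄) := by ring
  rw [g2, g3, g4]
  linarith

/-- The averagedness inequality. With `e = (z - Tz) - (z' - Tz')` and `F = diag(Q, 0, λ BᵀB, 0, …)`,
the defect exceeds `½⟨F(e - 2(z - z')), e - 2(z - z')⟩ ≥ 0`, by monotonicity and `P ⪰ (κ/2) F`. -/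
theorem StepRel.averaged (hκ : 0 < κ) (hlam : 0 < lam) (hγ₃ : 0 < γ₃)
    (hstep : StepSizes A L B M lam κ γ₁ γ₂ γ₃ γ₄) (hQ : (Q A L B lam).PosSemidef)
    {z z' w w' : H n l m p} (h : StepRel A y L B M lam C f g γ₁ γ₂ γ₃ γ₄ z w)
    (h' : StepRel A y L B M lam C f g γ₁ γ₂ γ₃ γ₄ z' w') :
    inner ℝ (w - w') (P L B M lam γ₁ γ₂ γ₃ γ₄ (w - w')) + (1 - 1 / κ) *
        inner ℝ ((z - w) - (z' - w')) (P L B M lam γ₁ γ₂ γ₃ γ₄ ((z - w) - (z' - w'))) ≤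
      inner ℝ (z - z') (P L B M lam γ₁ γ₂ γ₃ γ₄ (z - z')) := by
  have hmon := h.monotone hlam h'
  obtain ⟨-, hle⟩ := P_posDefOp hstep hκ hlam hγ₃ hQ
  have he : (z - w) - (z' - w') = (z - z') - (w - w') := by abel
  rw [he]
  set D := z - z'
  set E := w - w'
  have hsum : inner ℝ D (P L B M lam γ₁ γ₂ γ₃ γ₄ D) = inner ℝ E (P L B M lam γ₁ γ₂ γ₃ γ₄ E) +
      2 * inner ℝ E (P L B M lam γ₁ γ₂ γ₃ γ₄ (D - E)) +
      inner ℝ (D - E) (P L B M lam γ₁ γ₂ γ₃ γ₄ (D - E)) := by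
    have hs : inner ℝ D (P L B M lam γ₁ γ₂ γ₃ γ₄ E) = inner ℝ E (P L B M lam γ₁ γ₂ γ₃ γ₄ D) := by
      rw [← P_isSymmetric D E, real_inner_comm]
    simp only [map_sub, inner_sub_left, inner_sub_right, hs]
    ring
  have h1 := hle (D - E)
  have h2 : 1 / 2 * (inner ℝ (bx (D - E)) (act (Q A L B lam) (bx (D - E)))
      + lam * ‖act B (bv (D - E))‖ ^ 2) ≤
        1 / κ * inner ℝ (D - E) (P L B M lam γ₁ γ₂ γ₃ γ₄ (D - E)) := by
    have := mul_le_mul_of_nonneg_left h1 (show 0 ≤ 1 / κ by positivity)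
    refine le_trans (le_of_eq ?_) this
    field_simp
  have hbx : bx (D - E) = bx D - bx E := rfl
  have hbv : bv (D - E) = bv D - bv E := rfl
  have hQn := PosSemidef.inner_nonneg hQ (bx D + bx E)
  have hBn : 0 ≤ lam * ‖act B (bv D + bv E)‖ ^ 2 := by positivity
  rw [hbx, hbv] at h2
  simp only [← real_inner_self_eq_norm_sq, inner_Q, map_add, map_sub, inner_add_left,
    inner_add_right, inner_sub_left, inner_sub_right] at hQn hBn h2 hmon hsum ⊢
  rw [real_inner_comm (act A (bx E)) (act A (bx D)), real_inner_comm (act B (act L (bx E)))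
    (act B (act L (bx D)))] at hQn h2
  rw [real_inner_comm (act B (bv E)) (act B (bv D))] at hBn h2
  linarith

end Step

/-! ### The seed function and its partial minimization -/

section Seed

variable {m l p : ℕ}

/-- Partial minimization of the seed gives a real-valued convex function, bounded below and even,
with attained minima. -/
theorem exists_real_psi {φ : Pair m l → EReal} (hφ : Gamma0 φ)
    (hφpc : ∀ u : Vec m, Proper (fun σ : Vec l => φ (pair u σ)) ∧
      Coercive (fun σ : Vec l => φ (pair u σ)))
    (hbdd : ∃ c : ℝ, ∀ w : Pair m l, (c : EReal) ≤ φ w)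
    (hsymm : (∀ (u : Vec m) (σ : Vec l), φ (pair (-u) σ) = φ (pair u σ)) ∨
      (∀ (u : Vec m) (σ : Vec l), φ (pair (-u) σ) = φ (pair u (-σ)))) :
    ∃ ψ : Vec m → ℝ, (∀ u, psi φ u = ψ u) ∧ (∀ u σ, (ψ u : EReal) ≤ φ (pair u σ)) ∧
      (∀ u, ∃ σ, φ (pair u σ) = ψ u) ∧ ConvexOn ℝ univ ψ ∧ (∃ c, ∀ u, c ≤ ψ u) ∧
      ∀ u, ψ (-u) = ψ u := by
  have hatt : ∀ u, ∃ σ, ∀ σ', φ (pair u σ) ≤ φ (pair u σ') := by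
    intro u
    obtain ⟨⟨-, σ₀, hσ₀⟩, hcoer⟩ := hφpc u
    have hlsc : LowerSemicontinuous fun σ : Vec l => φ (pair u σ) :=
      hφ.2.1.comp (by fun_prop)
    have hev : ∀ᶠ σ in Bornology.cobounded (Vec l), φ (pair u σ₀) < φ (pair u σ) :=
      hcoer.eventually (lt_mem_nhds hσ₀)
    obtain ⟨R, -, hR⟩ :=
      (Metric.hasBasis_cobounded_compl_closedBall (0 : Vec l)).eventually_iff.1 hev
    obtain ⟨σ, -, hmin⟩ := LowerSemicontinuousOn.exists_isMinOn
      (s := Metric.closedBall (0 : Vec l) (max R ‖σ₀‖)) ⟨σ₀, by simp⟩ (isCompact_closedBall _ _)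
      (hlsc.lowerSemicontinuousOn _)
    refine ⟨σ, fun σ' => ?_⟩
    by_cases h : σ' ∈ Metric.closedBall (0 : Vec l) (max R ‖σ₀‖)
    · exact hmin h
    · have h1 : φ (pair u σ) ≤ φ (pair u σ₀) := hmin (by simp)
      refine h1.trans (hR ?_).le
      intro hmem
      exact h (Metric.closedBall_subset_closedBall (le_max_left _ _) hmem)
  choose s hs using hatt
  have hreal : ∀ u, ∃ a : ℝ, φ (pair u (s u)) = a := by
    intro u
    obtain ⟨σ₀, a₀, h₀⟩ := (hφpc u).1.exists_coe
    exact exists_coe_eq hφ.1.1 ((hs u σ₀).trans h₀.le)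
  choose ψ hψ using hreal
  have hle : ∀ u σ, (ψ u : EReal) ≤ φ (pair u σ) := fun u σ => hψ u ▸ hs u σ
  refine ⟨ψ, fun u => ?_, hle, fun u => ⟨s u, hψ u⟩, ?_, ?_, fun u => ?_⟩
  · exact le_antisymm (hψ u ▸ iInf_le _ (s u)) (le_iInf fun σ => hle u σ)
  · rw [convexOn_iff_forall_pos]
    refine ⟨convex_univ, fun u _ v _ a b ha hb hab => ?_⟩
    obtain rfl : b = 1 - a := by linarith
    have h1 := hφ.2.2.epiConvex (pair u (s u)) (pair v (s v)) (ψ u) (ψ v) a ha (by linarith)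
      (hψ u).le (hψ v).le
    exact EReal.coe_le_coe_iff.1
      ((hle (a • u + (1 - a) • v) (a • s u + (1 - a) • s v)).trans h1)
  · obtain ⟨c, hc⟩ := hbdd
    exact ⟨c, fun u => EReal.coe_le_coe_iff.1 ((hc _).trans (hψ u).le)⟩
  · have key : ∀ u, ψ (-u) ≤ ψ u := by
      intro u
      rcases hsymm with h | h
      · have h1 := hle (-u) (s u)
        rw [h, hψ] at h1
        exact EReal.coe_le_coe_iff.1 h1
      · have h1 := hle (-u) (-s u)
        rw [h, neg_neg, hψ] at h1
        exact EReal.coe_le_coe_iff.1 h1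
    refine le_antisymm (key u) ?_
    have := key (-u)
    rwa [neg_neg] at this

/-- Subgradients of the seed that vanish in the second variable are subgradients of the partial
minimum, at a minimizer. -/
lemma isSubgrad_pair_zero_iff {φ : Pair m l → EReal} {ψ : Vec m → ℝ}
    (hle : ∀ u σ, (ψ u : EReal) ≤ φ (pair u σ)) (hatt : ∀ u, ∃ σ, φ (pair u σ) = ψ u)
    {u r : Vec m} {σ : Vec l} : IsSubgrad φ (pair u σ) (pair r 0) ↔
      φ (pair u σ) = ψ u ∧ ∀ u', ψ u + inner ℝ r (u' - u) ≤ ψ u' := by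
  have hin : ∀ (u' : Vec m) (σ' : Vec l),
      inner ℝ (pair r (0 : Vec l)) (pair u' σ' - pair u σ) = inner ℝ r (u' - u) := fun u' σ' => by
    rw [WithLp.prod_inner_apply]
    simp
  constructor
  · rintro ⟨a, ha, h⟩
    have h1 : a = ψ u := by
      obtain ⟨σ', hσ'⟩ := hatt u
      have h2 := h _ _ hσ'.le
      rw [hin, sub_self, inner_zero_right, add_zero] at h2
      have h3 := hle u σ
      rw [ha, EReal.coe_le_coe_iff] at h3
      exact le_antisymm h2 h3
    subst h1
    refine ⟨ha, fun u' => ?_⟩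
    obtain ⟨σ', hσ'⟩ := hatt u'
    have h2 := h _ _ hσ'.le
    rwa [hin] at h2
  · rintro ⟨ha, h⟩
    refine ⟨ψ u, ha, fun w t ht => ?_⟩
    have h1 := (hle w.fst w.snd).trans ht
    have h2 := hin w.fst w.snd
    have h3 : pair w.fst w.snd = w := rfl
    rw [h3] at h2
    rw [h2]
    exact (h w.fst).trans (EReal.coe_le_coe_iff.1 h1)

lemma exists_coe_of_add_le {a b : EReal} (ha : a ≠ ⊥) (hb : b ≠ ⊥) {t : ℝ} (h : a + b ≤ t) :
    ∃ s s' : ℝ, a = s ∧ b = s' ∧ s + s' ≤ t := by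
  induction a using EReal.rec with
  | bot => exact absurd rfl ha
  | top =>
    rw [EReal.top_add_of_ne_bot hb] at h
    exact absurd h (not_le.2 (EReal.coe_lt_top _))
  | coe s =>
    induction b using EReal.rec with
    | bot => exact absurd rfl hb
    | top =>
      rw [EReal.coe_add_top] at h
      exact absurd h (not_le.2 (EReal.coe_lt_top _))
    | coe s' =>
      rw [← EReal.coe_add, EReal.coe_le_coe_iff] at h
      exact ⟨s, s', rfl, rfl, h⟩

/-- The subdifferential sum and chain rule for `f + g ∘ M̄`, for subgradients that vanish in the
second variable. The multiplier `ξ` separates the epigraph of the perturbation function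
`b ↦ inf_w [f w + g (M̄ w + b)]`, tilted by `r`, from the half-line below the origin. -/
theorem isSubgrad_add_comp_iff {φ f : Pair m l → EReal} {g : Vec p → EReal}
    {M : Matrix (Fin p) (Fin l) ℝ} (hf : Gamma0 f) (hg : Gamma0 g)
    (hrep : ∀ (u : Vec m) (σ : Vec l), φ (pair u σ) = f (pair u σ) + g (act M σ))
    (hri : (0 : Vec p) ∈ intrinsicInterior ℝ (dom g - Mbar M '' dom f))
    {u r : Vec m} {σ : Vec l} : IsSubgrad φ (pair u σ) (pair r 0) ↔
      ∃ ξ, IsSubgrad g (act M σ) ξ ∧ IsSubgrad f (pair u σ) (pair r (-act Mᵀ ξ)) := by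
  have hin : ∀ (s : Vec l) (w : Pair m l), inner ℝ (pair r s) (w - pair u σ) =
      inner ℝ r (w.fst - u) + inner ℝ s (w.snd - σ) := fun s w => by
    rw [WithLp.prod_inner_apply]
    rfl
  constructor
  · rintro ⟨a, ha, h⟩
    rw [hrep] at ha
    obtain ⟨af, ag, haf, hag, -⟩ := exists_coe_of_add_le (hf.1.1 _) (hg.1.1 _) ha.le
    rw [haf, hag, ← EReal.coe_add, EReal.coe_eq_coe_iff] at ha
    set U : Set (Vec p × ℝ) := {e | ∃ (w : Pair m l) (z : Vec p) (s s' : ℝ), f w ≤ s ∧ g z ≤ s' ∧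
      e.1 = z - act M w.snd ∧ s + s' - a - inner ℝ r (w.fst - u) ≤ e.2} with hU
    have hconv : Convex ℝ U := by
      rw [convex_iff_forall_pos]
      rintro e ⟨w, z, s, s', h1, h2, h3, h4⟩ e' ⟨w', z', t, t', h1', h2', h3', h4'⟩ b c hb hc hbc
      obtain rfl : c = 1 - b := by linarith
      refine ⟨b • w + (1 - b) • w', b • z + (1 - b) • z', b * s + (1 - b) * t,
        b * s' + (1 - b) * t', hf.2.2.epiConvex _ _ _ _ _ hb (by linarith) h1 h1',
        hg.2.2.epiConvex _ _ _ _ _ hb (by linarith) h2 h2', ?_, ?_⟩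
      · have e1 : (b • w + (1 - b) • w').snd = b • w.snd + (1 - b) • w'.snd := rfl
        rw [e1, Prod.fst_add, Prod.smul_fst, Prod.smul_fst, h3, h3']
        simp only [map_add, map_smul]
        module
      · have e1 : (b • w + (1 - b) • w').fst - u = b • (w.fst - u) + (1 - b) • (w'.fst - u) := by
          change b • w.fst + (1 - b) • w'.fst - u = _
          module
        rw [e1, Prod.snd_add, Prod.smul_snd, Prod.smul_snd, inner_add_right, inner_smul_right,
          inner_smul_right, smul_eq_mul, smul_eq_mul]
        have := mul_le_mul_of_nonneg_left h4 hb.le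
        have := mul_le_mul_of_nonneg_left h4' hc.le
        linarith
    have hproj : Prod.fst '' U = dom g - Mbar M '' dom f := by
      ext b
      constructor
      · rintro ⟨e, ⟨w, z, s, s', h1, h2, h3, -⟩, rfl⟩
        rw [h3]
        exact sub_mem_sub (h2.trans_lt (EReal.coe_lt_top _))
          (mem_image_of_mem (Mbar M) (h1.trans_lt (EReal.coe_lt_top _)))
      · rintro ⟨z, hz, _, ⟨w, hw, rfl⟩, rfl⟩
        exact ⟨(z - act M w.snd, _), ⟨w, z, (f w).toReal, (g z).toReal,
          (EReal.coe_toReal (ne_of_lt hw) (hf.1.1 w)).ge,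
          (EReal.coe_toReal (ne_of_lt hz) (hg.1.1 z)).ge, rfl, le_rfl⟩, rfl⟩
    obtain ⟨ξ, hξ⟩ := exists_linear_le_of_mem_intrinsicInterior hconv (by rwa [hproj]) (by
      rintro t ⟨w, z, s, s', h1, h2, h3, h4⟩
      have h5 : z = act M w.snd := (sub_eq_zero.1 h3.symm)
      have h6 : φ w ≤ ((s + s' : ℝ) : EReal) := by
        have h7 : φ w = f w + g (act M w.snd) := hrep w.fst w.snd
        rw [h7, ← h5, EReal.coe_add]
        exact add_le_add h1 h2
      have h8 := h w _ h6
      rw [hin, inner_zero_left, add_zero] at h8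
      linarith)
    have key : ∀ (w : Pair m l) (z : Vec p) (s s' : ℝ), f w ≤ s → g z ≤ s' →
        inner ℝ ξ (z - act M w.snd) ≤ s + s' - a - inner ℝ r (w.fst - u) :=
      fun w z s s' h1 h2 => hξ (z - act M w.snd, s + s' - a - inner ℝ r (w.fst - u))
        ⟨w, z, s, s', h1, h2, rfl, le_rfl⟩
    refine ⟨ξ, ⟨ag, hag, fun z t ht => ?_⟩, ⟨af, haf, fun w t ht => ?_⟩⟩
    · have h1 := key (pair u σ) z af t haf.le ht
      have h2 : (pair u σ).fst - u = 0 := sub_self u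
      rw [h2, inner_zero_right] at h1
      change inner ℝ ξ (z - act M σ) ≤ _ at h1
      linarith
    · have h1 := key w (act M σ) t ag ht hag.le
      rw [hin, inner_neg_left, act_transpose_inner, map_sub]
      simp only [inner_sub_right] at h1 ⊢
      linarith
  · rintro ⟨ξ, ⟨ag, hag, hgs⟩, ⟨af, haf, hfs⟩⟩
    refine ⟨af + ag, by rw [hrep, haf, hag, EReal.coe_add], fun w t ht => ?_⟩
    have h7 : φ w = f w + g (act M w.snd) := hrep w.fst w.snd
    rw [h7] at ht
    obtain ⟨s, s', hs, hs', hst⟩ := exists_coe_of_add_le (hf.1.1 _) (hg.1.1 _) ht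
    have h1 := hfs w s hs.le
    have h2 := hgs _ s' hs'.le
    rw [hin, inner_neg_left, act_transpose_inner, map_sub] at h1
    rw [hin, inner_zero_left, add_zero]
    linarith

end Seed

/-! ### The generalized Moreau envelope -/

section Envelope

variable {E F : Type*} [NormedAddCommGroup E] [InnerProductSpace ℝ E] [NormedAddCommGroup F]
  [InnerProductSpace ℝ F] {ψ : E → ℝ} {B : E →ₗ[ℝ] F}

/-- `v` minimizes `ψ + ½‖B(u - ·)‖²`. -/
def IsEnvMin (ψ : E → ℝ) (B : E →ₗ[ℝ] F) (u v : E) : Prop :=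
  ∀ w, ψ v + 1 / 2 * ‖B (u - v)‖ ^ 2 ≤ ψ w + 1 / 2 * ‖B (u - w)‖ ^ 2

/-- First-order characterization of the minimizers that define the envelope. -/
lemma isEnvMin_iff (hψ : ConvexOn ℝ univ ψ) {u v : E} :
    IsEnvMin ψ B u v ↔ ∀ w, ψ v + inner ℝ (B (u - v)) (B (w - v)) ≤ ψ w := by
  have hexp : ∀ (w : E) (t : ℝ), ‖B (u - (t • w + (1 - t) • v))‖ ^ 2 = ‖B (u - v)‖ ^ 2 -
      2 * (t * inner ℝ (B (u - v)) (B (w - v))) + t ^ 2 * ‖B (w - v)‖ ^ 2 := fun w t => by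
    have e : u - (t • w + (1 - t) • v) = (u - v) - t • (w - v) := by module
    rw [e, map_sub, map_smul, norm_sub_sq_real, inner_smul_right, norm_smul, mul_pow,
      Real.norm_eq_abs, sq_abs]
  constructor
  · intro h w
    have key : 0 ≤ ψ w - ψ v - inner ℝ (B (u - v)) (B (w - v)) := by
      apply nonneg_of_quadratic (K := 1 / 2 * ‖B (w - v)‖ ^ 2)
      intro t ht ht1
      have h1 := h (t • w + (1 - t) • v)
      have h2 := hψ.2 (mem_univ w) (mem_univ v) ht.le (sub_nonneg.2 ht1.le) (by ring)
      rw [hexp] at h1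
      simp only [smul_eq_mul] at h2
      linarith
    linarith
  · intro h w
    have h1 := h w
    have h2 := hexp w 1
    rw [sub_self, zero_smul, add_zero, one_smul, one_mul] at h2
    rw [h2]
    nlinarith [sq_nonneg ‖B (w - v)‖]

variable {V : E → E}

lemma envelope_convex (hψ : ConvexOn ℝ univ ψ) (hV : ∀ u, IsEnvMin ψ B u (V u)) :
    ConvexOn ℝ univ fun u => ψ (V u) + 1 / 2 * ‖B (u - V u)‖ ^ 2 := by
  refine ⟨convex_univ, fun u _ w _ a b ha hb hab => ?_⟩
  have h1 := hV (a • u + b • w) (a • V u + b • V w)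
  have h2 := hψ.2 (mem_univ (V u)) (mem_univ (V w)) ha hb hab
  have e : a • u + b • w - (a • V u + b • V w) = a • (u - V u) + b • (w - V w) := by module
  have h3 : ‖B (a • (u - V u) + b • (w - V w))‖ ^ 2 ≤
      a * ‖B (u - V u)‖ ^ 2 + b * ‖B (w - V w)‖ ^ 2 := by
    have h4 : 0 ≤ a * b * ‖B (u - V u) - B (w - V w)‖ ^ 2 := by positivity
    obtain rfl : b = 1 - a := by linarith
    rw [map_add, map_smul, map_smul, norm_add_sq_real]
    rw [norm_sub_sq_real] at h4
    simp only [norm_smul, mul_pow, Real.norm_eq_abs, sq_abs, inner_smul_left, inner_smul_right,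
      RCLike.conj_to_real]
    linarith
  rw [e] at h1
  simp only [smul_eq_mul] at h2 ⊢
  linarith

/-- The quadratic upper bound of the envelope at `u`, for any minimizer `v`. -/
lemma envelope_le (hV : ∀ u, IsEnvMin ψ B u (V u)) {u v : E} (e : E) :
    ψ (V (u + e)) + 1 / 2 * ‖B (u + e - V (u + e))‖ ^ 2 ≤
      ψ v + 1 / 2 * ‖B (u - v)‖ ^ 2 + inner ℝ (B (u - v)) (B e) + 1 / 2 * ‖B e‖ ^ 2 := by
  have h1 := hV (u + e) v
  have h2 : u + e - v = (u - v) + e := by abel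
  rw [h2, map_add, norm_add_sq_real] at h1
  linarith

/-- The quadratic lower bound of the envelope; with `envelope_le`, the envelope is differentiable
with gradient `Bᵀ B (u - v)`. It follows from the upper bound at `-e` by convexity. -/
lemma le_envelope (hψ : ConvexOn ℝ univ ψ) (hV : ∀ u, IsEnvMin ψ B u (V u)) (u e : E) :
    ψ (V u) + 1 / 2 * ‖B (u - V u)‖ ^ 2 + inner ℝ (B (u - V u)) (B e) - 1 / 2 * ‖B e‖ ^ 2 ≤
      ψ (V (u + e)) + 1 / 2 * ‖B (u + e - V (u + e))‖ ^ 2 := by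
  have h1 := envelope_le hV (u := u) (v := V u) (-e)
  have h2 := (envelope_convex hψ hV).2 (mem_univ (u + e)) (mem_univ (u + -e))
    (show (0 : ℝ) ≤ 1 / 2 by norm_num) (show (0 : ℝ) ≤ 1 / 2 by norm_num) (by norm_num)
  have h3 : (1 / 2 : ℝ) • (u + e) + (1 / 2 : ℝ) • (u + -e) = u := by module
  rw [h3] at h2
  rw [map_neg, inner_neg_right, norm_neg] at h1
  simp only [smul_eq_mul] at h2
  linarith

end Envelope

/-! ### Optimality conditions -/

section Optimality

variable {d n m l p q : ℕ} {A : Matrix (Fin d) (Fin n) ℝ} {y : Vec d}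
  {L : Matrix (Fin m) (Fin n) ℝ} {B : Matrix (Fin q) (Fin m) ℝ} {M : Matrix (Fin p) (Fin l) ℝ}
  {lam : ℝ} {C : Set (Vec n)} {φ f : Pair m l → EReal} {g : Vec p → EReal} {ψ : Vec m → ℝ}
  {V : Vec m → Vec m}

lemma J_eq_coe (hψφ : ∀ u, psi φ u = ψ u) (hV : ∀ u, IsEnvMin ψ (act B) u (V u)) (x : Vec n) :
    J A y L B lam φ x = ((1 / 2 * ‖y - act A x‖ ^ 2 + lam * (ψ (act L x) -
      (ψ (V (act L x)) + 1 / 2 * ‖act B (act L x - V (act L x))‖ ^ 2)) : ℝ) : EReal) := by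
  have h : ∀ u : Vec m, (⨅ v : Vec m, psi φ v + ((1 / 2 * ‖act B (u - v)‖ ^ 2 : ℝ) : EReal)) =
      ((ψ (V u) + 1 / 2 * ‖act B (u - V u)‖ ^ 2 : ℝ) : EReal) := by
    intro u
    refine le_antisymm ((iInf_le _ (V u)).trans ?_) (le_iInf fun v => ?_)
    · rw [hψφ, ← EReal.coe_add]
    · rw [hψφ, ← EReal.coe_add, EReal.coe_le_coe_iff]
      exact hV u v
  rw [J, Psi, h, hψφ, ← EReal.coe_sub, ← EReal.coe_mul, ← EReal.coe_add]

/-- Minimizers exist over a compact set, as `J` is real-valued and continuous. -/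
lemma sol_nonempty (hψφ : ∀ u, psi φ u = ψ u) (hψ : ConvexOn ℝ univ ψ)
    (hV : ∀ u, IsEnvMin ψ (act B) u (V u)) (hCne : C.Nonempty) (hC : IsCompact C) :
    (Sol A y L B lam φ C).Nonempty := by
  have h1 : Continuous ψ := continuousOn_univ.1 (hψ.continuousOn isOpen_univ)
  have h2 : Continuous fun u => ψ (V u) + 1 / 2 * ‖act B (u - V u)‖ ^ 2 :=
    continuousOn_univ.1 ((envelope_convex hψ hV).continuousOn isOpen_univ)
  have hA : Continuous (act A) := (act A).continuous_of_finiteDimensional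
  have hL : Continuous (act L) := (act L).continuous_of_finiteDimensional
  have h3 : Continuous fun x => 1 / 2 * ‖y - act A x‖ ^ 2 + lam * (ψ (act L x) -
      (ψ (V (act L x)) + 1 / 2 * ‖act B (act L x - V (act L x))‖ ^ 2)) := by
    have h4 := h2.comp hL
    have h5 := h1.comp hL
    simp only [Function.comp_def] at h4 h5
    fun_prop
  obtain ⟨x, hx, hmin⟩ := hC.exists_isMinOn hCne h3.continuousOn
  refine ⟨x, hx, fun w hw => ?_⟩
  rw [J_eq_coe hψφ hV, J_eq_coe hψφ hV, EReal.coe_le_coe_iff]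
  exact hmin hw

lemma inner_gradient (x e : Vec n) (v r : Vec m) : inner ℝ (-(act (Q A L B lam) x - act Aᵀ y
    + lam • act (Lᵀ * Bᵀ * B) v + lam • act Lᵀ r)) e =
    inner ℝ (y - act A x) (act A e) + lam * inner ℝ (act B (act L x - v)) (act B (act L e))
      - lam * inner ℝ r (act L e) := by
  rw [real_inner_comm]
  simp only [inner_neg_right, inner_add_right, inner_sub_right, inner_smul_right, act_mul, inner_Q,
    inner_act_transpose, map_sub, inner_sub_left]
  rw [real_inner_comm (act A x) (act A e), real_inner_comm y (act A e),
    real_inner_comm (act B (act L x)) (act B (act L e)),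
    real_inner_comm (act B v) (act B (act L e)), real_inner_comm r (act L e)]
  ring

/-- First-order optimality for `J` over `C`. Necessity linearizes the smooth part of `J`, and a
separation argument splits the subgradient of `λ ψ ∘ L` from the normal to `C`; sufficiency is the
convexity that `Q ⪰ 0` provides. -/
theorem mem_sol_iff (hlam : 0 < lam) (hCconv : Convex ℝ C) (hψφ : ∀ u, psi φ u = ψ u)
    (hψ : ConvexOn ℝ univ ψ) (hV : ∀ u, IsEnvMin ψ (act B) u (V u))
    (hQ : (Q A L B lam).PosSemidef) (x : Vec n) :
    x ∈ Sol A y L B lam φ C ↔ x ∈ C ∧ ∃ r v : Vec m,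
      (∀ u, ψ (act L x) + inner ℝ r (u - act L x) ≤ ψ u) ∧ IsEnvMin ψ (act B) (act L x) v ∧
      ∀ c ∈ C, inner ℝ (-(act (Q A L B lam) x - act Aᵀ y
        + lam • act (Lᵀ * Bᵀ * B) v + lam • act Lᵀ r)) (c - x) ≤ 0 := by
  simp only [Sol, mem_ofPred_eq, J_eq_coe hψφ hV, EReal.coe_le_coe_iff]
  refine and_congr_right fun hx => ⟨fun h => ?_, ?_⟩
  · set v := V (act L x)
    have hdir : ∀ w ∈ C, 0 ≤ -inner ℝ (y - act A x) (act A (w - x))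
        + lam * (ψ (act L w) - ψ (act L x))
        - lam * inner ℝ (act B (act L x - v)) (act B (act L (w - x))) := by
      intro w hw
      apply nonneg_of_quadratic
        (K := 1 / 2 * ‖act A (w - x)‖ ^ 2 + lam / 2 * ‖act B (act L (w - x))‖ ^ 2)
      intro t ht ht1
      have h1 := h (x + t • (w - x)) (hCconv.add_smul_sub_mem hx hw ⟨ht.le, ht1.le⟩)
      have e1 : act L (x + t • (w - x)) = act L x + t • act L (w - x) := by
        rw [map_add, map_smul]
      have e2 : y - act A (x + t • (w - x)) = (y - act A x) - t • act A (w - x) := by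
        rw [map_add, map_smul]
        abel
      have h2 := le_envelope hψ hV (act L x) (t • act L (w - x))
      have h3 : ψ (act L x + t • act L (w - x)) ≤ (1 - t) * ψ (act L x) + t * ψ (act L w) := by
        have h4 := hψ.2 (mem_univ (act L x)) (mem_univ (act L w)) (sub_nonneg.2 ht1.le) ht.le
          (by ring)
        have e3 : (1 - t) • act L x + t • act L w = act L x + t • act L (w - x) := by
          rw [map_sub]
          module
        rw [e3] at h4
        exact h4
      rw [e1, e2, norm_sub_sq_real (y - act A x), inner_smul_right, norm_smul, mul_pow,
        Real.norm_eq_abs, sq_abs] at h1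
      rw [map_smul, inner_smul_right, norm_smul, mul_pow, Real.norm_eq_abs, sq_abs] at h2
      have h5 := mul_le_mul_of_nonneg_left h2 hlam.le
      have h6 := mul_le_mul_of_nonneg_left h3 hlam.le
      linarith
    -- separate in the space of perturbations `b` of `L w`
    set U : Set (Vec m × ℝ) := {e | ∃ w ∈ C, -inner ℝ (y - act A x) (act A (w - x))
        + lam * (ψ (act L w + e.1) - ψ (act L x))
        - lam * inner ℝ (act B (act L x - v)) (act B (act L (w - x))) ≤ e.2} with hU
    have hconv : Convex ℝ U := by
      rintro ⟨b, s⟩ ⟨w, hw, h1⟩ ⟨b', s'⟩ ⟨w', hw', h1'⟩ a c ha hc hac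
      refine ⟨a • w + c • w', hCconv hw hw' ha hc hac, ?_⟩
      have h2 := hψ.2 (mem_univ (act L w + b)) (mem_univ (act L w' + b')) ha hc hac
      have e1 : act L (a • w + c • w') + (a • b + c • b') =
          a • (act L w + b) + c • (act L w' + b') := by
        simp only [map_add, map_smul]
        module
      have e2 : a • w + c • w' - x = a • (w - x) + c • (w' - x) := by
        have : x = (a + c) • x := by rw [hac, one_smul]
        nth_rewrite 1 [this]
        module
      simp only [Prod.smul_mk, Prod.mk_add_mk, smul_eq_mul, e2] at h1 h1' h2 ⊢
      rw [e1]
      simp only [map_add, map_smul, inner_add_right, inner_smul_right]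
      have h3 := mul_le_mul_of_nonneg_left h1 ha
      have h4 := mul_le_mul_of_nonneg_left h1' hc
      have h5 := mul_le_mul_of_nonneg_left h2 hlam.le
      obtain rfl : c = 1 - a := by linarith
      linarith
    have hproj : Prod.fst '' U = univ :=
      eq_univ_of_forall fun b =>
        ⟨(b, lam * (ψ (act L x + b) - ψ (act L x))), ⟨x, hx, by simp⟩, rfl⟩
    obtain ⟨ξ, hξ⟩ := exists_linear_le_of_mem_intrinsicInterior hconv
      (interior_subset_intrinsicInterior (by rw [hproj, interior_univ]; trivial)) (by
        rintro t ⟨w, hw, h1⟩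
        have h2 := hdir w hw
        rw [add_zero] at h1
        exact h2.trans h1)
    have key : ∀ w ∈ C, ∀ u, inner ℝ ξ (u - act L w) ≤ -inner ℝ (y - act A x) (act A (w - x))
        + lam * (ψ u - ψ (act L x))
        - lam * inner ℝ (act B (act L x - v)) (act B (act L (w - x))) := fun w hw u =>
      hξ (u - act L w, _) ⟨w, hw, by simp⟩
    refine ⟨lam⁻¹ • ξ, v, fun u => ?_, hV _, fun c hc => ?_⟩
    · have h1 := key x hx u
      simp only [sub_self, map_zero, inner_zero_right, mul_zero, neg_zero, zero_add, sub_zero] at h1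
      have h2 := mul_le_mul_of_nonneg_left h1 (inv_nonneg.2 hlam.le)
      rw [inv_mul_cancel_left₀ hlam.ne'] at h2
      rw [inner_smul_left, RCLike.conj_to_real]
      linarith
    · have h1 := key c hc (act L x)
      rw [inner_gradient, inner_smul_left, RCLike.conj_to_real, mul_inv_cancel_left₀ hlam.ne']
      rw [← neg_sub (act L c), ← map_sub, inner_neg_right, sub_self, mul_zero] at h1
      linarith
  · rintro ⟨r, v, hr, hv, hn⟩ w hw
    have h1 := hn w hw
    rw [inner_gradient] at h1
    have h2 := hr (act L w)
    have h3 := envelope_le hV (u := act L x) (v := v) (act L (w - x))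
    have h4 := hv (V (act L x))
    have e1 : act L x + act L (w - x) = act L w := by rw [← map_add, add_sub_cancel]
    have e2 : y - act A w = (y - act A x) - act A (w - x) := by
      rw [map_sub]
      abel
    have h5 := PosSemidef.inner_nonneg hQ (w - x)
    rw [inner_Q, real_inner_self_eq_norm_sq, real_inner_self_eq_norm_sq] at h5
    rw [e1] at h3
    rw [← map_sub] at h2
    rw [e2, norm_sub_sq_real (y - act A x)]
    have h6 := mul_le_mul_of_nonneg_left h2 hlam.le
    have h7 := mul_le_mul_of_nonneg_left h3 hlam.le
    have h8 := mul_le_mul_of_nonneg_left h4 hlam.le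
    linarith

lemma stepRel_self_iff {γ₁ γ₂ γ₃ γ₄ : ℝ} {z : H n l m p} :
    StepRel A y L B M lam C f g γ₁ γ₂ γ₃ γ₄ z z ↔
      (bx z ∈ C ∧ ∀ c ∈ C, inner ℝ (-(act (Q A L B lam) (bx z) - act Aᵀ y
        + lam • act (Lᵀ * Bᵀ * B) (bv z) + lam • act Lᵀ (br z))) (c - bx z) ≤ 0) ∧
      bη z = -act Mᵀ (bξ z) ∧
      IsSubgrad f (pair (bv z) (bτ z))
        (pair (act (Bᵀ * B) (act L (bx z) - bv z)) (-act Mᵀ (bζ z))) ∧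
      IsSubgrad f (pair (act L (bx z)) (bσ z)) (pair (br z) (bη z)) ∧
      IsSubgrad g (act M (bσ z)) (bξ z) ∧ IsSubgrad g (act M (bτ z)) (bζ z) := by
  have e : ∀ {k : ℕ} (a : Vec k), (2 : ℝ) • a - a = a := fun a => by module
  constructor
  · rintro ⟨h0, h1, h2, h3, h4, h5, h6⟩
    simp only [sub_self, smul_zero, zero_sub, zero_add, e] at h1 h2 h3 h4 h5 h6
    exact ⟨⟨h0, h1⟩, eq_neg_of_add_eq_zero_left h2.symm, h3, h4, h5, h6⟩
  · rintro ⟨⟨h0, h1⟩, h2, h3, h4, h5, h6⟩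
    refine ⟨h0, ?_, ?_, ?_, ?_, ?_, ?_⟩ <;>
      simp only [sub_self, smul_zero, zero_sub, zero_add, e]
    · exact h1
    · rw [h2, neg_add_cancel]
    · exact h3
    · exact h4
    · exact h5
    · exact h6

/-- The solutions are the `x`-blocks of the points related to themselves by the step. -/
theorem mem_sol_iff_stepRel (hlam : 0 < lam) (hCconv : Convex ℝ C) (hf : Gamma0 f) (hg : Gamma0 g)
    (hrep : ∀ (u : Vec m) (σ : Vec l), φ (pair u σ) = f (pair u σ) + g (act M σ))
    (hri : (0 : Vec p) ∈ intrinsicInterior ℝ (dom g - Mbar M '' dom f))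
    (hQ : (Q A L B lam).PosSemidef) (hψφ : ∀ u, psi φ u = ψ u)
    (hle : ∀ u σ, (ψ u : EReal) ≤ φ (pair u σ)) (hatt : ∀ u, ∃ σ, φ (pair u σ) = ψ u)
    (hψ : ConvexOn ℝ univ ψ) (hV : ∀ u, IsEnvMin ψ (act B) u (V u)) {γ₁ γ₂ γ₃ γ₄ : ℝ} (x : Vec n) :
    x ∈ Sol A y L B lam φ C ↔
      ∃ (σ : Vec l) (v : Vec m) (τ : Vec l) (r : Vec m) (η : Vec l) (ξ ζ : Vec p),
        StepRel A y L B M lam C f g γ₁ γ₂ γ₃ γ₄ (mk x σ v τ r η ξ ζ) (mk x σ v τ r η ξ ζ) := by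
  have hv_iff : ∀ v, IsEnvMin ψ (act B) (act L x) v ↔
      ∀ w, ψ v + inner ℝ (act (Bᵀ * B) (act L x - v)) (w - v) ≤ ψ w := fun v => by
    simp only [isEnvMin_iff hψ, act_mul, act_transpose_inner]
  rw [mem_sol_iff hlam hCconv hψφ hψ hV hQ]
  simp only [stepRel_self_iff]
  constructor
  · rintro ⟨hx, r, v, hr, hv, hn⟩
    obtain ⟨σ, hσ⟩ := hatt (act L x)
    obtain ⟨τ, hτ⟩ := hatt v
    obtain ⟨ξ, hξ, hξf⟩ := (isSubgrad_add_comp_iff hf hg hrep hri).1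
      ((isSubgrad_pair_zero_iff hle hatt).2 ⟨hσ, hr⟩)
    obtain ⟨ζ, hζ, hζf⟩ := (isSubgrad_add_comp_iff hf hg hrep hri).1
      ((isSubgrad_pair_zero_iff hle hatt).2 ⟨hτ, (hv_iff v).1 hv⟩)
    exact ⟨σ, v, τ, r, -act Mᵀ ξ, ξ, ζ, ⟨hx, hn⟩, rfl, hζf, hξf, hξ, hζ⟩
  · rintro ⟨σ, v, τ, r, η, ξ, ζ, ⟨hx, hn⟩, hη, h3, h4, h5, h6⟩
    change η = -act Mᵀ ξ at hη
    subst hη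
    have h7 := (isSubgrad_pair_zero_iff hle hatt).1
      ((isSubgrad_add_comp_iff hf hg hrep hri).2 ⟨ξ, h5, h4⟩)
    have h8 := (isSubgrad_pair_zero_iff hle hatt).1
      ((isSubgrad_add_comp_iff hf hg hrep hri).2 ⟨ζ, h6, h3⟩)
    exact ⟨hx, r, v, h7.2, (hv_iff v).2 h8.2, hn⟩

lemma algStep_eq_T {γ₁ γ₂ γ₃ γ₄ : ℝ} (z : H n l m p) :
    algStep A y L B M lam C f g γ₁ γ₂ γ₃ γ₄ z = T A y L B M lam C f g γ₁ γ₂ γ₃ γ₄ z := by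
  have h : act (Q A L B lam) (bx z) - act Aᵀ y
        + lam • act Lᵀ (act (Bᵀ * B) (bv z) + br z) =
      act (Q A L B lam) (bx z) - act Aᵀ y
        + lam • act (Lᵀ * Bᵀ * B) (bv z) + lam • act Lᵀ (br z) := by
    simp only [act_mul, map_add, smul_add, add_assoc]
  simp only [algStep, T, h]

end Optimality

end GMEMI

theorem theorem2 {d n m l p q : ℕ}
    (A : Matrix (Fin d) (Fin n) ℝ) (y : Vec d) (L : Matrix (Fin m) (Fin n) ℝ)
    (B : Matrix (Fin q) (Fin m) ℝ) (M : Matrix (Fin p) (Fin l) ℝ)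
    (lam : ℝ) (hlam : 0 < lam)
    (C : Set (Vec n)) (hCne : C.Nonempty) (hCcl : IsClosed C) (hCconv : Convex ℝ C)
    (φ f : Pair m l → EReal) (g : Vec p → EReal)
    (hφ : Gamma0 φ) (hf : Gamma0 f) (hg : Gamma0 g)
    -- the seed is proper and coercive in its second variable
    (hφpc : ∀ u : Vec m, Proper (fun σ : Vec l => φ (pair u σ)) ∧
      Coercive (fun σ : Vec l => φ (pair u σ)))
    -- the representation of the seed
    (hrep : ∀ (u : Vec m) (σ : Vec l), φ (pair u σ) = f (pair u σ) + g (act M σ))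
    -- boundedness, symmetry and relative interior conditions
    (hbdd : ∃ c : ℝ, ∀ w : Pair m l, (c : EReal) ≤ φ w)
    (hsymm : (∀ (u : Vec m) (σ : Vec l), φ (pair (-u) σ) = φ (pair u σ)) ∨
      (∀ (u : Vec m) (σ : Vec l), φ (pair (-u) σ) = φ (pair u (-σ))))
    (hri₁ : (0 : Pair m l) ∈
      intrinsicInterior ℝ (dom φ - Set.range (Lbar L : Pair n l → Pair m l)))
    (hri₂ : (0 : Vec p) ∈ intrinsicInterior ℝ (dom g - Mbar M '' dom f))
    -- overall convexity
    (hQ : (Q A L B lam).PosSemidef) :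
    (∀ κ : ℝ, 1 < κ →
      -- admissible step sizes exist
      (∀ δ : ℝ, 0 < δ → ∀ γ₁ γ₂ γ₃ γ₄ : ℝ,
        γ₁ = 1 / (opNorm ((κ / 2) • (Aᵀ * A) + lam • (Lᵀ * L)) + δ) →
        γ₂ = 1 / (opNorm M ^ 2 + 1 + δ) →
        γ₃ = 1 / ((κ / 2 + 2 / κ) * opNorm B ^ 2 + δ) →
        γ₄ = 1 / (γ₃ * opNorm M ^ 2 + δ) →
        0 < γ₁ ∧ 0 < γ₂ ∧ 0 < γ₃ ∧ 0 < γ₄ ∧ StepSizes A L B M lam κ γ₁ γ₂ γ₃ γ₄) ∧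
      ∀ γ₁ γ₂ γ₃ γ₄ : ℝ, 0 < γ₁ → 0 < γ₂ → 0 < γ₃ → 0 < γ₄ →
        StepSizes A L B M lam κ γ₁ γ₂ γ₃ γ₄ →
        -- the solutions are the first blocks of the fixed points
        (∀ x : Vec n, x ∈ Sol A y L B lam φ C ↔
          ∃ (σ : Vec l) (v : Vec m) (τ : Vec l) (r : Vec m) (η : Vec l) (ξ ζ : Vec p),
            mk x σ v τ r η ξ ζ ∈
              Function.fixedPoints (T A y L B M lam C f g γ₁ γ₂ γ₃ γ₄)) ∧
        -- averaged nonexpansiveness in the weighted norm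
        PosDefOp (P L B M lam γ₁ γ₂ γ₃ γ₄) ∧
        AveragedNonexpansive (opWeightedNorm (P L B M lam γ₁ γ₂ γ₃ γ₄)) (κ / (2 * κ - 1))
          (T A y L B M lam C f g γ₁ γ₂ γ₃ γ₄) ∧
        -- convergence of the algorithm
        ((Sol A y L B lam φ C).Nonempty → ∀ z₀ : H n l m p,
          ∃ x ∈ Sol A y L B lam φ C,
            Tendsto (fun k => bx (iterates A y L B M lam C f g γ₁ γ₂ γ₃ γ₄ z₀ k)) atTop (𝓝 x))) ∧
    -- solutions exist when the constraint set is bounded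
    (Bornology.IsBounded C → (Sol A y L B lam φ C).Nonempty) := by
  obtain ⟨ψ, hψφ, hle, hatt, hψ, ⟨c₀, hc₀⟩, heven⟩ := exists_real_psi hφ hφpc hbdd hsymm
  choose V hV using fun u => exists_min_even_add_sq hψ heven hc₀ (act B) u
  refine ⟨fun κ hκ => ⟨fun δ hδ γ₁ γ₂ γ₃ γ₄ h₁ h₂ h₃ h₄ =>
    stepSizes_of_eq A L B M lam (by linarith) hδ h₁ h₂ h₃ h₄, ?_⟩, fun hC =>
      sol_nonempty hψφ hψ hV hCne (Metric.isCompact_of_isClosed_isBounded hCcl hC)⟩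
  intro γ₁ γ₂ γ₃ γ₄ hγ₁ hγ₂ hγ₃ hγ₄ hstep
  have hκ0 : 0 < κ := by linarith
  have hT : ∀ {z w : H n l m p}, T A y L B M lam C f g γ₁ γ₂ γ₃ γ₄ z = w ↔
      StepRel A y L B M lam C f g γ₁ γ₂ γ₃ γ₄ z w :=
    T_eq_iff hCne hCcl hCconv hf hg hγ₁ hγ₂ hγ₃ hγ₄
  have hsol : ∀ x : Vec n, x ∈ Sol A y L B lam φ C ↔
      ∃ (σ : Vec l) (v : Vec m) (τ : Vec l) (r : Vec m) (η : Vec l) (ξ ζ : Vec p),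
        mk x σ v τ r η ξ ζ ∈ Function.fixedPoints (T A y L B M lam C f g γ₁ γ₂ γ₃ γ₄) := by
    intro x
    simp only [Function.mem_fixedPoints, Function.IsFixedPt, hT]
    exact mem_sol_iff_stepRel hlam hCconv hf hg hrep hri₂ hQ hψφ hle hatt hψ hV x
  obtain ⟨hpd, -⟩ := P_posDefOp (n := n) (l := l) (m := m) (p := p) hstep hκ0 hlam hγ₃ hQ
  have havg : ∀ z w : H n l m p, _ := fun z w =>
    (hT.1 rfl : StepRel A y L B M lam C f g γ₁ γ₂ γ₃ γ₄ z _).averaged hκ0 hlam hγ₃ hstep hQ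
      (hT.1 rfl : StepRel A y L B M lam C f g γ₁ γ₂ γ₃ γ₄ w _)
  refine ⟨hsol, hpd, ?_, ?_⟩
  · have hden : 0 < 2 * κ - 1 := by linarith
    refine averagedNonexpansive_of_le hpd (by positivity) (by rw [div_lt_one hden]; linarith) ?_
    have hα : (1 - κ / (2 * κ - 1)) / (κ / (2 * κ - 1)) = 1 - 1 / κ := by
      rw [one_sub_div hden.ne', div_div_div_cancel_right₀ hden.ne']
      field_simp
      ring
    rw [hα]
    exact havg
  · rintro ⟨x₀, hx₀⟩ z₀
    obtain ⟨σ, v, τ, r, η, ξ, ζ, hfix⟩ := (hsol x₀).1 hx₀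
    have hc : 0 < 1 - 1 / κ := by
      rw [sub_pos, div_lt_one hκ0]
      exact hκ
    obtain ⟨z, hz, hlim⟩ := tendsto_fixedPoint_of_averaged hpd hc havg ⟨_, hfix⟩
      (z := iterates A y L B M lam C f g γ₁ γ₂ γ₃ γ₄ z₀) (fun k => algStep_eq_T _)
    refine ⟨bx z, (hsol _).2 ⟨bσ z, bv z, bτ z, br z, bη z, bξ z, bζ z, hz⟩, ?_⟩
    have hbx : Continuous (bx : H n l m p → Vec n) := by
      unfold bx
      fun_prop
    exact (hbx.tendsto z).comp hlim
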